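/- Let $\Gamma$ and $\Lambda$ be countable locally finite groups (every finitely generated subgroup is finite), equipped with metrics $d_\Gamma$ and $d_\Lambda$ that are left-invariant ($d(gs,gt)=d(s,t)$) and proper (closed bounded subsets are finite). For such a metric space $X$, let $C^*_u(X)$ be the uniform Roe algebra of $X$: the operator-norm closure in $B(\ell^2(X))$ of the $*$-algebra of all bounded operators $T$ of finite propagation, i.e. such that for some $R>0$ one has $\langle T\delta_{x'},\delta_x\rangle=0$ whenever $d(x,x')>R$. It contains $\ell^\infty(X)$ as the algebra of diagonal operators. For a unital $C^*$-algebra $A$, let $K_0(A)$ be the Grothendieck group of the semigroup of Murray–von Neumann equivalence classes of projections in the matrix algebras $M_n(A)$, $n\ge 0$, under orthogonal sum, let $K_0(A)^+$ be the set of all classes $[p]_0$ of such projections, and let $[1]_0$ be the class of the unit of $A$. Then the following are equivalent: (1) $(\Gamma,d_\Gamma)$ and $(\Lambda,d_\Lambda)$ are bijectively coarsely equivalent: there is a bijection $f:\Gamma\to\Lambda$ that is a coarse equivalence, i.e. $f$ is bornologous (for every $R>0$ there is $S>0$ such that $d_\Gamma(x,x')\le R$ implies $d_\Lambda(f(x),f(x'))\le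 S$) and there is a bornologous map $g:\Lambda\to\Gamma$ such that $d_\Lambda(f(g(y)),y)$ and $d_\Gamma(g(f(x)),x)$ are bounded functions of $y\in\Lambda$ and of $x\in\Gamma$, respectively; (2) there is a $*$-isomorphism $\varphi:C^*_u(\Gamma)\to C^*_u(\Lambda)$ such that $\varphi(\ell^\infty(\Gamma))=\ell^\infty(\Lambda)$; (3) $C^*_u(\Gamma)$ and $C^*_u(\Lambda)$ are $*$-isomorphic; (4) $(K_0(C^*_u(\Gamma)),K_0(C^*_u(\Gamma))^+,[1]_0)\cong(K_0(C^*_u(\Lambda)),K_0(C^*_u(\Lambda))^+,[1]_0)$, i.e. there is a group isomorphism $K_0(C^*_u(\Gamma))\to K_0(C^*_u(\Lambda))$ that maps the positive cone onto the positive cone and $[1]_0$ to $[1]_0$; (5) $(K_0(C^*_u(\Gamma)),[1]_0)\cong(K_0(C^*_u(\Lambda)),[1]_0)$, i.e. there is a group isomorphism $K_0(C^*_u(\Gamma))\to K_0(C^*_u(\Lambda))$ that maps $[1]_0$ to $[1]_0$. -/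

import Mathlib

open scoped ENNReal

namespace UniformRoe

/-! ### Groups -/

/-- A group is locally finite if all its finitely generated subgroups are finite. -/
def LocallyFiniteGroup (G : Type*) [Group G] : Prop :=
  ∀ H : Subgroup G, H.FG → Finite H

/-- The metric of `G` is left-invariant. -/
def LeftInvariantMetric (G : Type*) [Group G] [MetricSpace G] : Prop :=
  ∀ g s t : G, dist (g * s) (g * t) = dist s t

/-- The metric is proper: closed bounded subsets are finite. -/
def ProperDiscreteMetric (X : Type*) [MetricSpace X] : Prop :=
  ∀ S : Set X, IsClosed S → Bornology.IsBounded S → S.Finite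

/-! ### Coarse geometry -/

section Coarse

variable {X Y : Type*} [MetricSpace X] [MetricSpace Y]

def Bornologous (f : X → Y) : Prop :=
  ∀ R : ℝ, 0 < R → ∃ S : ℝ, 0 < S ∧ ∀ x x' : X, dist x x' ≤ R → dist (f x) (f x') ≤ S

/-- Two maps are close if `x ↦ dist (f x) (f' x)` is bounded. -/
def Close (f f' : X → Y) : Prop :=
  ∃ C : ℝ, ∀ x : X, dist (f x) (f' x) ≤ C

def IsCoarseEquivalence (f : X → Y) : Prop :=
  Bornologous f ∧ ∃ g : Y → X, Bornologous g ∧ Close (f ∘ g) id ∧ Close (g ∘ f) id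

variable (X Y) in
def BijectivelyCoarselyEquivalent : Prop :=
  ∃ f : X → Y, IsCoarseEquivalence f ∧ Function.Bijective f

end Coarse

/-! ### The uniform Roe algebra -/

section Roe

/-- The Hilbert space of square-summable complex functions on `X`. -/
abbrev Ell2 (X : Type*) : Type _ := lp (fun _ : X => ℂ) 2

open Classical in
/-- The canonical basis vector at the point `x`. -/
noncomputable def delta {X : Type*} (x : X) : Ell2 X := lp.single 2 x (1 : ℂ)

theorem inner_delta_left {X : Type*} (x : X) (ξ : Ell2 X) : inner ℂ (delta x) ξ = ξ x := by
  classical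
  have := lp.inner_single_left (𝕜 := ℂ) (G := fun _ : X => ℂ) x (1 : ℂ) ξ
  simp only [delta]
  convert this using 1
  simp

theorem inner_delta_delta {X : Type*} {x y : X} (h : x ≠ y) :
    inner ℂ (delta x) (delta y) = (0 : ℂ) := by
  classical
  rw [inner_delta_left, delta]
  exact lp.single_apply_ne _ _ _ h

/-- `T` has propagation at most `R`: its matrix coefficients at points of distance
larger than `R` vanish. -/
def PropagationLE {X : Type*} [MetricSpace X] (R : ℝ) (T : Ell2 X →L[ℂ] Ell2 X) : Prop :=
  ∀ x x' : X, R < dist x x' → inner ℂ (delta x) (T (delta x')) = (0 : ℂ)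

def FinitePropagation {X : Type*} [MetricSpace X] (T : Ell2 X →L[ℂ] Ell2 X) : Prop :=
  ∃ R : ℝ, 0 < R ∧ PropagationLE R T

section Lemmas

variable {X : Type*} [MetricSpace X] {R R' : ℝ} {S T : Ell2 X →L[ℂ] Ell2 X}

theorem PropagationLE.mono (h : PropagationLE R T) (hR : R ≤ R') : PropagationLE R' T :=
  fun x x' hx => h x x' (hR.trans_lt hx)

theorem PropagationLE.add (hS : PropagationLE R S) (hT : PropagationLE R T) :
    PropagationLE R (S + T) := fun x x' hx => by
  rw [add_apply, inner_add_right, hS x x' hx, hT x x' hx, add_zero]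

theorem PropagationLE.star (hT : PropagationLE R T) : PropagationLE R (star T) :=
  fun x x' hx => by
    rw [ContinuousLinearMap.star_eq_adjoint, ContinuousLinearMap.adjoint_inner_right,
      ← inner_conj_symm, hT x' x (by rwa [dist_comm]), map_zero]

theorem PropagationLE.mul (hS : PropagationLE R S) (hT : PropagationLE R' T) :
    PropagationLE (R + R') (S * T) := fun x x' hx => by
  change inner ℂ (delta x) (S (T (delta x'))) = (0 : ℂ)
  rw [← ContinuousLinearMap.adjoint_inner_left,
    lp.inner_eq_tsum]
  have key : ∀ z : X, inner ℂ ((ContinuousLinearMap.adjoint S (delta x) : Ell2 X) z)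
      ((T (delta x') : Ell2 X) z) = (0 : ℂ) := by
    intro z
    by_cases hz : R' < dist z x'
    · have := hT z x' hz
      rw [inner_delta_left] at this
      rw [this, inner_zero_right]
    · have hzx : R < dist z x := by
        have h1 := dist_triangle x z x'
        rw [dist_comm x z] at h1
        linarith [not_lt.mp hz]
      have := hS.star z x hzx
      rw [inner_delta_left, ContinuousLinearMap.star_eq_adjoint] at this
      rw [this, inner_zero_left]
  exact (tsum_congr key).trans tsum_zero

theorem propagationLE_algebraMap (hR : 0 ≤ R) (c : ℂ) :
    PropagationLE R (algebraMap ℂ (Ell2 X →L[ℂ] Ell2 X) c) := fun x x' hx => by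
  have hne : x ≠ x' := by
    rintro rfl
    rw [dist_self] at hx
    exact absurd hR (not_le.mpr hx)
  rw [ContinuousLinearMap.algebraMap_apply, inner_smul_right, inner_delta_delta hne, mul_zero]

end Lemmas

/-- The `*`-algebra of all bounded operators of finite propagation. -/
noncomputable def algebraicRoe (X : Type*) [MetricSpace X] :
    StarSubalgebra ℂ (Ell2 X →L[ℂ] Ell2 X) where
  carrier := {T | FinitePropagation T}
  mul_mem' := by
    rintro S T ⟨R, hR, hS⟩ ⟨R', hR', hT⟩
    exact ⟨R + R', add_pos hR hR', hS.mul hT⟩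
  add_mem' := by
    rintro S T ⟨R, hR, hS⟩ ⟨R', hR', hT⟩
    exact ⟨max R R', lt_max_of_lt_left hR,
      (hS.mono (le_max_left _ _)).add (hT.mono (le_max_right _ _))⟩
  algebraMap_mem' := fun c => ⟨1, one_pos, propagationLE_algebraMap zero_le_one c⟩
  star_mem' := by
    rintro T ⟨R, hR, hT⟩
    exact ⟨R, hR, hT.star⟩

/-- The uniform Roe algebra: the operator-norm closure of the finite propagation operators. -/
noncomputable def uniformRoeAlgebra (X : Type*) [MetricSpace X] :
    StarSubalgebra ℂ (Ell2 X →L[ℂ] Ell2 X) :=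
  (algebraicRoe X).topologicalClosure

theorem norm_mul_apply_le {X : Type*} (f : lp (fun _ : X => ℂ) ∞) (x : X) :
    ‖ContinuousLinearMap.mul ℂ ℂ (f x)‖ ≤ ‖f‖ := by
  rw [ContinuousLinearMap.opNorm_mul_apply]
  exact lp.norm_apply_le_norm ENNReal.top_ne_zero f x

/-- The diagonal operator `ξ ↦ (x ↦ f x * ξ x)` of a bounded function `f`. -/
noncomputable def diagonalOperator {X : Type*} (f : lp (fun _ : X => ℂ) ∞) :
    Ell2 X →L[ℂ] Ell2 X :=
  lp.mapCLM 2 (fun x => ContinuousLinearMap.mul ℂ ℂ (f x)) (norm_nonneg f) (norm_mul_apply_le f)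

/-- The copy of `ℓ^∞(X)` inside the uniform Roe algebra, as diagonal operators. -/
def ellInfty (X : Type*) [MetricSpace X] : Set (uniformRoeAlgebra X) :=
  {T | ∃ f : lp (fun _ : X => ℂ) ∞, (T : Ell2 X →L[ℂ] Ell2 X) = diagonalOperator f}

end Roe

/-! ### The group `K₀` of a unital C*-algebra -/

section KTheory

variable {A : Type*} [Ring A] [StarRing A]

/-- Murray–von Neumann equivalence of matrices of possibly different finite sizes:
`p = v* v` and `q = v v*` for some rectangular matrix `v`. -/
def MvN {m n : Type} [Fintype m] [Fintype n] (p : Matrix m m A) (q : Matrix n n A) : Prop :=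
  ∃ v : Matrix n m A, v.conjTranspose * v = p ∧ v * v.conjTranspose = q

section Lemmas

variable {k l m n : Type} [Fintype k] [Fintype l] [Fintype m] [Fintype n]

theorem MvN.refl {p : Matrix m m A} (hp : IsStarProjection p) : MvN p p :=
  ⟨p, by
    have h1 : p.conjTranspose = p := hp.isSelfAdjoint
    have h2 : p * p = p := hp.isIdempotentElem
    rw [h1, h2]; exact ⟨rfl, rfl⟩⟩

theorem MvN.symm {p : Matrix m m A} {q : Matrix n n A} (h : MvN p q) : MvN q p := by
  obtain ⟨v, h1, h2⟩ := h
  exact ⟨v.conjTranspose, by rwa [Matrix.conjTranspose_conjTranspose],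
    by rwa [Matrix.conjTranspose_conjTranspose]⟩

theorem MvN.trans {p : Matrix m m A} {q : Matrix n n A} {r : Matrix l l A}
    (hp : IsStarProjection p) (hr : IsStarProjection r)
    (h : MvN p q) (h' : MvN q r) : MvN p r := by
  obtain ⟨v, h1, h2⟩ := h
  obtain ⟨w, h3, h4⟩ := h'
  have hpp : p * p = p := hp.isIdempotentElem
  have hrr : r * r = r := hr.isIdempotentElem
  refine ⟨w * v, ?_, ?_⟩
  · calc (w * v).conjTranspose * (w * v)
        = v.conjTranspose * (w.conjTranspose * w) * v := by
          simp only [Matrix.conjTranspose_mul, Matrix.mul_assoc]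
      _ = (v.conjTranspose * v) * (v.conjTranspose * v) := by
          rw [h3, ← h2]; simp only [Matrix.mul_assoc]
      _ = p := by rw [h1, hpp]
  · calc (w * v) * (w * v).conjTranspose
        = w * (v * v.conjTranspose) * w.conjTranspose := by
          simp only [Matrix.conjTranspose_mul, Matrix.mul_assoc]
      _ = (w * w.conjTranspose) * (w * w.conjTranspose) := by
          rw [h2, ← h3]; simp only [Matrix.mul_assoc]
      _ = r := by rw [h4, hrr]

/-- The orthogonal sum `diag(p, q)`. -/
def blockSum (p : Matrix m m A) (q : Matrix n n A) : Matrix (m ⊕ n) (m ⊕ n) A :=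
  Matrix.fromBlocks p 0 0 q

theorem blockSum_proj {p : Matrix m m A} {q : Matrix n n A}
    (hp : IsStarProjection p) (hq : IsStarProjection q) : IsStarProjection (blockSum p q) := by
  have h1 : p.conjTranspose = p := hp.isSelfAdjoint
  have h2 : p * p = p := hp.isIdempotentElem
  have h3 : q.conjTranspose = q := hq.isSelfAdjoint
  have h4 : q * q = q := hq.isIdempotentElem
  refine ⟨?_, ?_⟩
  · change blockSum p q * blockSum p q = blockSum p q
    simp [blockSum, Matrix.fromBlocks_multiply, h2, h4]
  · change (blockSum p q).conjTranspose = blockSum p q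
    simp [blockSum, Matrix.fromBlocks_conjTranspose, h1, h3]

theorem MvN.blockSum {p : Matrix k k A} {p' : Matrix l l A} {q : Matrix m m A} {q' : Matrix n n A}
    (h : MvN p p') (h' : MvN q q') :
    MvN (UniformRoe.blockSum p q) (UniformRoe.blockSum p' q') := by
  obtain ⟨v, h1, h2⟩ := h
  obtain ⟨w, h3, h4⟩ := h'
  refine ⟨Matrix.fromBlocks v 0 0 w, ?_, ?_⟩ <;>
    simp [UniformRoe.blockSum, Matrix.fromBlocks_conjTranspose, Matrix.fromBlocks_multiply,
      h1, h2, h3, h4]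

theorem isStarProjection_reindex {p : Matrix m m A} (hp : IsStarProjection p) (e : m ≃ n) :
    IsStarProjection (Matrix.reindex e e p) := by
  have h1 : p.conjTranspose = p := hp.isSelfAdjoint
  have h2 : p * p = p := hp.isIdempotentElem
  refine ⟨?_, ?_⟩
  · change Matrix.reindex e e p * Matrix.reindex e e p = Matrix.reindex e e p
    rw [Matrix.reindex_apply, Matrix.submatrix_mul_equiv, h2]
  · change (Matrix.reindex e e p).conjTranspose = Matrix.reindex e e p
    rw [Matrix.reindex_apply, Matrix.conjTranspose_submatrix, h1]

theorem MvN.reindex {p : Matrix m m A} (hp : IsStarProjection p) (e : m ≃ n) :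
    MvN p (Matrix.reindex e e p) := by
  have h1 : p.conjTranspose = p := hp.isSelfAdjoint
  have h2 : p * p = p := hp.isIdempotentElem
  refine ⟨p.submatrix e.symm id, ?_, ?_⟩
  · rw [Matrix.conjTranspose_submatrix, h1, Matrix.submatrix_mul_equiv, h2, Matrix.submatrix_id_id]
  · rw [Matrix.conjTranspose_submatrix, h1, Matrix.reindex_apply]
    have := Matrix.submatrix_mul_equiv p p e.symm (Equiv.refl m) e.symm
    rw [h2] at this
    simpa using this

theorem blockSum_comm {p : Matrix m m A} {q : Matrix n n A}
    (hp : IsStarProjection p) (hq : IsStarProjection q) :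
    MvN (blockSum p q) (blockSum q p) := by
  have h := MvN.reindex (blockSum_proj hp hq) (Equiv.sumComm m n)
  rwa [show Matrix.reindex (Equiv.sumComm m n) (Equiv.sumComm m n) (blockSum p q) = blockSum q p
    from Matrix.fromBlocks_submatrix_sum_swap_sum_swap _ _ _ _] at h

theorem blockSum_assoc {p : Matrix l l A} {q : Matrix m m A} {r : Matrix n n A}
    (hp : IsStarProjection p) (hq : IsStarProjection q) (hr : IsStarProjection r) :
    MvN (blockSum (blockSum p q) r) (blockSum p (blockSum q r)) := by
  have h := MvN.reindex (blockSum_proj (blockSum_proj hp hq) hr) (Equiv.sumAssoc l m n)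
  rwa [show Matrix.reindex (Equiv.sumAssoc l m n) (Equiv.sumAssoc l m n)
      (blockSum (blockSum p q) r) = blockSum p (blockSum q r) from by
    ext (i | i | i) (j | j | j) <;> rfl] at h

theorem blockSum_empty [IsEmpty m] {z : Matrix m m A} {p : Matrix n n A}
    (hz : IsStarProjection z) (hp : IsStarProjection p) : MvN (blockSum z p) p := by
  have h := MvN.reindex (blockSum_proj hz hp) (Equiv.emptySum m n)
  rwa [show Matrix.reindex (Equiv.emptySum m n) (Equiv.emptySum m n) (blockSum z p) = p from by
    ext i j; rfl] at h

end Lemmas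

variable (A) in
/-- All projections in the matrix algebras `M_n(A)`. -/
def MatrixProjection : Type _ :=
  Σ n : ℕ, {p : Matrix (Fin n) (Fin n) A // IsStarProjection p}

/-- `p ⊕ q = diag(p, q)`, a projection in `M_{m+n}(A)`. -/
def MatrixProjection.sum (p q : MatrixProjection A) : MatrixProjection A :=
  ⟨p.1 + q.1, Matrix.reindex finSumFinEquiv finSumFinEquiv (blockSum p.2.1 q.2.1),
    isStarProjection_reindex (blockSum_proj p.2.2 q.2.2) finSumFinEquiv⟩

variable (A) in
/-- Murray–von Neumann equivalence on all matrix projections. -/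
instance mvnSetoid : Setoid (MatrixProjection A) where
  r p q := MvN p.2.1 q.2.1
  iseqv :=
    { refl := fun p => MvN.refl p.2.2
      symm := fun h => h.symm
      trans := fun {p _ r} h h' => MvN.trans p.2.2 r.2.2 h h' }

theorem MatrixProjection.mvn_sum (p q : MatrixProjection A) :
    MvN (blockSum p.2.1 q.2.1) (p.sum q).2.1 :=
  MvN.reindex (blockSum_proj p.2.2 q.2.2) finSumFinEquiv

theorem MatrixProjection.sum_equiv {p q p' q' : MatrixProjection A}
    (h : MvN (blockSum p.2.1 q.2.1) (blockSum p'.2.1 q'.2.1)) :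
    (p.sum q) ≈ (p'.sum q') :=
  MvN.trans (p.sum q).2.2 (p'.sum q').2.2 (p.mvn_sum q).symm
    (MvN.trans (blockSum_proj p.2.2 q.2.2) (p'.sum q').2.2 h (p'.mvn_sum q'))

variable (A) in
/-- The Murray–von Neumann semigroup: equivalence classes of projections in matrices over `A`. -/
def MvNSemigroup : Type _ := Quotient (mvnSetoid A)

/-- The class of a projection in `M_n(A)`. -/
def MvNSemigroup.mk (p : MatrixProjection A) : MvNSemigroup A := Quotient.mk (mvnSetoid A) p

/-- The zero projection, as the unique `0 × 0` matrix. -/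
def MatrixProjection.zero : MatrixProjection A := ⟨0, 0, IsStarProjection.zero _⟩

instance : Zero (MvNSemigroup A) := ⟨MvNSemigroup.mk MatrixProjection.zero⟩

instance : Add (MvNSemigroup A) :=
  ⟨Quotient.map₂ MatrixProjection.sum
    (fun _ _ h _ _ h' => MatrixProjection.sum_equiv (MvN.blockSum h h'))⟩

theorem MvNSemigroup.mk_add (p q : MatrixProjection A) :
    MvNSemigroup.mk p + MvNSemigroup.mk q = MvNSemigroup.mk (p.sum q) := rfl

theorem MvNSemigroup.add_comm' (a b : MvNSemigroup A) : a + b = b + a := by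
  induction a using Quotient.inductionOn with | _ p => ?_
  induction b using Quotient.inductionOn with | _ q => ?_
  exact Quotient.sound (MatrixProjection.sum_equiv (blockSum_comm p.2.2 q.2.2))

theorem MvNSemigroup.zero_add' (a : MvNSemigroup A) : 0 + a = a := by
  induction a using Quotient.inductionOn with | _ p => ?_
  have h : MvN (blockSum (MatrixProjection.zero (A := A)).2.1 p.2.1) p.2.1 :=
    blockSum_empty (m := Fin 0) (MatrixProjection.zero (A := A)).2.2 p.2.2
  exact Quotient.sound (MvN.trans (MatrixProjection.zero.sum p).2.2 p.2.2
    (MatrixProjection.zero.mvn_sum p).symm h)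

theorem MvNSemigroup.add_assoc' (a b c : MvNSemigroup A) : a + b + c = a + (b + c) := by
  induction a using Quotient.inductionOn with | _ p => ?_
  induction b using Quotient.inductionOn with | _ q => ?_
  induction c using Quotient.inductionOn with | _ r => ?_
  refine Quotient.sound (MatrixProjection.sum_equiv ?_)
  have h1 : MvN (blockSum (p.sum q).2.1 r.2.1) (blockSum (blockSum p.2.1 q.2.1) r.2.1) :=
    MvN.blockSum (p.mvn_sum q).symm (MvN.refl r.2.2)
  have h2 : MvN (blockSum p.2.1 (blockSum q.2.1 r.2.1)) (blockSum p.2.1 (q.sum r).2.1) :=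
    MvN.blockSum (MvN.refl p.2.2) (q.mvn_sum r)
  have hpqr := blockSum_proj p.2.2 (blockSum_proj q.2.2 r.2.2)
  exact MvN.trans (blockSum_proj (p.sum q).2.2 r.2.2) (blockSum_proj p.2.2 (q.sum r).2.2)
    (MvN.trans (blockSum_proj (p.sum q).2.2 r.2.2) hpqr h1
      (blockSum_assoc p.2.2 q.2.2 r.2.2)) h2

instance : AddCommMonoid (MvNSemigroup A) where
  add_assoc := MvNSemigroup.add_assoc'
  zero_add := MvNSemigroup.zero_add'
  add_zero a := by rw [MvNSemigroup.add_comm', MvNSemigroup.zero_add']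
  add_comm := MvNSemigroup.add_comm'
  nsmul := nsmulRec

variable (A) in
/-- The `K₀`-group of a unital C*-algebra `A` (only its `*`-ring structure enters):
the Grothendieck group of the Murray–von Neumann semigroup. -/
abbrev K0 : Type _ := Algebra.GrothendieckAddGroup (MvNSemigroup A)

/-- The class `[p]₀` of a projection `p` in `M_n(A)`. -/
noncomputable def K0.cls (p : MatrixProjection A) : K0 A :=
  Algebra.GrothendieckAddGroup.of (MvNSemigroup.mk p)

variable (A) in
/-- The positive cone `K₀(A)⁺`, the set of all classes of projections. -/
def K0.positiveCone : Set (K0 A) := Set.range K0.cls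

variable (A) in
/-- The class `[1]₀` of the unit of `A`, viewed in `M_1(A)`. -/
noncomputable def K0.unit : K0 A := K0.cls ⟨1, 1, IsStarProjection.one _⟩

variable (A) in
/-- `(K₀(A), K₀(A)⁺, [1]₀) ≅ (K₀(B), K₀(B)⁺, [1]₀)`. -/
def OrderedK0Iso (B : Type*) [Ring B] [StarRing B] : Prop :=
  ∃ φ : K0 A ≃+ K0 B, φ '' K0.positiveCone A = K0.positiveCone B ∧ φ (K0.unit A) = K0.unit B

variable (A) in
/-- `(K₀(A), [1]₀) ≅ (K₀(B), [1]₀)`. -/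
def PointedK0Iso (B : Type*) [Ring B] [StarRing B] : Prop :=
  ∃ φ : K0 A ≃+ K0 B, φ (K0.unit A) = K0.unit B

end KTheory

end UniformRoe

/-! A bijective coarse equivalence permutes the bases of the two Hilbert spaces, and conjugation by
the resulting unitary preserves finite propagation and diagonal operators. After that everything
down to (5) is functoriality of `K0`. The content lies in (5) ⇒ (1): the pointed group `K0`
remembers which numbers divide the order of a finite subgroup, and these numbers determine the group
up to bijective coarse equivalence.

Divisibility is visible in `K0` in both directions. If `F` is a finite subgroup, right translations
by elements of `F` carry a transversal of the left cosets onto disjoint sets that fill the group.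
They have finite propagation by left-invariance, so `[1]₀` is `|F|` times the class of the indicator
of the transversal (`exists_card_nsmul_eq_unit`). Conversely, exhaust the group by finite subgroups
`F k`. An operator of finite propagation eventually leaves `ℓ²(F k)` invariant, so compression to
`ℓ²(F k)` is asymptotically multiplicative on the uniform Roe algebra. Compressed projections are
close to projections, and their ranks define a homomorphism from `K0` to germs of integer sequences
that sends `[1]₀` to `(|F k|)` (`IsQuasicentral.rankHom`). Hence a divisor of `[1]₀` divides some
`|F k|` (`IsQuasicentral.exists_dvd_card`).

For the geometry, number the group so that the left cosets of each `F k` are exactly the blocks of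
`|F k|` consecutive labels (`IsExhaustion.exists_labelling`). If the orders in two exhaustions
divide one another cofinally, the same labels occur in both groups, and matching labels sends cosets
into cosets. Points at bounded distance are those sharing a coset of a fixed `F k`, so this
bijection and its inverse are bornologous. -/

namespace UniformRoe

/-! ### Block labellings of locally finite groups -/

section Labelling

/-- A labelling of a subgroup `H` of a finite group extends to a labelling of the group in which
the left cosets of `H` are consecutive blocks of labels. -/
theorem exists_extend_labelling {K : Type*} [Group K] [Finite K] (H : Subgroup K) (φ : K → ℕ)
    (hφ : Set.InjOn φ H) (hlt : ∀ x ∈ H, φ x < Nat.card H) :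
    ∃ ψ : K → ℕ, Function.Injective ψ ∧ (∀ x, ψ x < Nat.card K) ∧ Set.EqOn ψ φ H ∧
      (∀ x y, ψ x / Nat.card H = ψ y / Nat.card H → x⁻¹ * y ∈ H) ∧
      ∀ x y, x⁻¹ * y ∈ H → ψ x / Nat.card H = ψ y / Nat.card H ∧ ∃ x' ∈ H, ∃ y' ∈ H,
        x'⁻¹ * y' = x⁻¹ * y ∧ ψ x % Nat.card H = φ x' ∧ ψ y % Nat.card H = φ y' := by
  classical
  have hH : 0 < Nat.card H := Nat.card_pos
  -- The coset `H` gets number 0 and, below, representative 1; this makes the new labelling agree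
  -- with `φ` on `H`.
  obtain ⟨e, he⟩ : ∃ e : K ⧸ H ≃ Fin H.index, (e (1 : K) : ℕ) = 0 := by
    have e₀ : K ⧸ H ≃ Fin H.index := Finite.equivFin _
    have hi : 0 < H.index := Nat.card_pos
    exact ⟨e₀.trans (Equiv.swap (e₀ (1 : K)) ⟨0, hi⟩), by simp⟩
  obtain ⟨s, hs, hs1⟩ : ∃ s : K ⧸ H → K, (∀ q, (s q : K ⧸ H) = q) ∧ s (1 : K) = 1 := by
    refine ⟨Function.update Quotient.out ((1 : K) : K ⧸ H) 1, fun q => ?_, by simp⟩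
    by_cases hq : q = ((1 : K) : K ⧸ H)
    · subst hq; simp
    · rw [Function.update_of_ne hq]; exact QuotientGroup.out_eq' q
  have hmem : ∀ x : K, (s x)⁻¹ * x ∈ H := fun x => QuotientGroup.eq.mp (hs x)
  -- Quotient by `|H|`: the number of the coset. Remainder: the label of the position within the
  -- coset, moved back to `H` by left translation.
  set ψ : K → ℕ := fun x => φ ((s x)⁻¹ * x) + Nat.card H * e x with hψ
  have hdiv : ∀ x, ψ x / Nat.card H = e x := fun x => by
    rw [hψ]; dsimp only
    rw [Nat.add_mul_div_left _ _ hH, Nat.div_eq_of_lt (hlt _ (hmem x)), zero_add]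
  have hmod : ∀ x, ψ x % Nat.card H = φ ((s x)⁻¹ * x) := fun x => by
    rw [hψ]; dsimp only
    rw [Nat.add_mul_mod_self_left, Nat.mod_eq_of_lt (hlt _ (hmem x))]
  have hcoset : ∀ x y, ψ x / Nat.card H = ψ y / Nat.card H → (x : K ⧸ H) = y := fun x y h => by
    rw [hdiv, hdiv] at h
    exact e.injective (Fin.ext h)
  refine ⟨ψ, fun x y h => ?_, fun x => ?_, fun x hx => ?_, fun x y h => ?_, fun x y h => ?_⟩
  · have h1 := hcoset x y (by rw [h])
    have h2 : φ ((s x)⁻¹ * x) = φ ((s y)⁻¹ * y) := by rw [← hmod, ← hmod, h]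
    have h3 := hφ (hmem x) (hmem y) h2
    rw [h1] at h3
    exact mul_left_cancel h3
  · have h1 : (e x : ℕ) + 1 ≤ H.index := (e x).2
    have h2 := hlt _ (hmem x)
    rw [← H.card_mul_index]
    calc ψ x < Nat.card H + Nat.card H * e x := Nat.add_lt_add_right h2 _
      _ = Nat.card H * (e x + 1) := by ring
      _ ≤ _ := Nat.mul_le_mul_left _ h1
  · have h1 : (x : K ⧸ H) = (1 : K) := (QuotientGroup.eq.mpr (by simpa using hx)).symm
    simp only [hψ, h1, hs1, he]
    simp
  · exact QuotientGroup.eq.mp (hcoset x y h)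
  · have h1 : (x : K ⧸ H) = y := QuotientGroup.eq.mpr h
    refine ⟨by rw [hdiv, hdiv, h1], _, hmem x, _, hmem y, ?_, hmod x, hmod y⟩
    rw [h1]; group

variable {G : Type*} [Group G]

/-- `φ` labels the elements of `F k` by the numbers below the order of `F k`, in such a way that
for `j ≤ k` the left cosets of `F j` are the blocks of length `|F j|`. -/
structure IsLabelling (F : ℕ → Subgroup G) (k : ℕ) (φ : G → ℕ) : Prop where
  injOn : Set.InjOn φ (F k)
  lt : ∀ x ∈ F k, φ x < Nat.card (F k)
  block : ∀ j ≤ k, ∀ x ∈ F k, ∀ y ∈ F k,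
    x⁻¹ * y ∈ F j ↔ φ x / Nat.card (F j) = φ y / Nat.card (F j)

/-- Blocks of length `b` start at multiples of `a`, so inside one of them the division into blocks
of length `a` depends only on remainders modulo `b`. -/
theorem div_eq_div_iff_of_dvd {a b m n : ℕ} (hab : a ∣ b) (hb : 0 < b) (h : m / b = n / b) :
    m / a = n / a ↔ m % b / a = n % b / a := by
  obtain ⟨c, rfl⟩ := hab
  have ha : 0 < a := Nat.pos_of_mul_pos_right hb
  have key : ∀ l : ℕ, l / a = l % (a * c) / a + c * (l / (a * c)) := fun l => by
    conv_lhs => rw [← Nat.mod_add_div l (a * c), mul_assoc, Nat.add_mul_div_left _ _ ha]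
  rw [key m, key n, h]
  exact Nat.add_right_cancel_iff

theorem IsLabelling.exists_succ {F : ℕ → Subgroup G} (hF : Monotone F) (hfin : ∀ k, Finite (F k))
    {k : ℕ} {φ : G → ℕ} (h : IsLabelling F k φ) :
    ∃ ψ : G → ℕ, IsLabelling F (k + 1) ψ ∧ Set.EqOn ψ φ (F k) := by
  classical
  have hle : F k ≤ F (k + 1) := hF k.le_succ
  have := hfin (k + 1)
  have := hfin k
  have hcard : Nat.card ((F k).subgroupOf (F (k + 1))) = Nat.card (F k) :=
    Nat.card_congr (Subgroup.subgroupOfEquivOfLe hle).toEquiv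
  obtain ⟨ψ, hinj, hlt, heq, hb1, hb2⟩ := exists_extend_labelling ((F k).subgroupOf (F (k + 1)))
    (fun x => φ x) (fun x hx y hy hxy => Subtype.ext (h.injOn hx hy hxy))
    (fun x hx => by rw [hcard]; exact h.lt x hx)
  rw [hcard] at hb1 hb2
  set ψ' : G → ℕ := fun x => if hx : x ∈ F (k + 1) then ψ ⟨x, hx⟩ else 0
  have hψ' : ∀ x (hx : x ∈ F (k + 1)), ψ' x = ψ ⟨x, hx⟩ := fun x hx => dif_pos hx
  refine ⟨ψ', ⟨fun x hx y hy hxy => ?_, fun x hx => ?_, fun j hj x hx y hy => ?_⟩,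
    fun x hx => ?_⟩
  · rw [hψ' x hx, hψ' y hy] at hxy
    exact congrArg Subtype.val (hinj hxy)
  · rw [hψ' x hx]; exact hlt _
  · rw [hψ' x hx, hψ' y hy]
    rcases hj.lt_or_eq with hj | rfl
    · have hj : j ≤ k := Nat.lt_succ_iff.mp hj
      have hdvd : Nat.card (F j) ∣ Nat.card (F k) := Subgroup.card_dvd_of_le (hF hj)
      have hpos : 0 < Nat.card (F k) := Nat.card_pos
      -- Within one coset of `F k` the new labels copy `φ` on a left translate, which leaves `x⁻¹ *
      -- y` unchanged; the claim reduces to the block property of `φ`.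
      have key : x⁻¹ * y ∈ F k → (x⁻¹ * y ∈ F j ↔
          ψ ⟨x, hx⟩ / Nat.card (F j) = ψ ⟨y, hy⟩ / Nat.card (F j)) := fun hxy => by
        obtain ⟨h1, x', hx', y', hy', h2, h3, h4⟩ := hb2 ⟨x, hx⟩ ⟨y, hy⟩ hxy
        have h2' : (x' : G)⁻¹ * y' = x⁻¹ * y := congrArg Subtype.val h2
        rw [div_eq_div_iff_of_dvd hdvd hpos h1, h3, h4, ← h2']
        exact h.block j hj x' hx' y' hy'
      refine ⟨fun hxy => (key (hF hj hxy)).mp hxy, fun hxy => (key ?_).mpr hxy⟩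
      refine hb1 ⟨x, hx⟩ ⟨y, hy⟩ ?_
      -- Blocks of length `|F j|` lie inside blocks of length `|F k|`, so a common small block
      -- forces a common coset of `F k`.
      obtain ⟨c, hc⟩ := hdvd
      rw [hc, ← Nat.div_div_eq_div_mul, ← Nat.div_div_eq_div_mul, hxy]
    · rw [Nat.div_eq_of_lt (hlt _), Nat.div_eq_of_lt (hlt _)]
      exact ⟨fun _ => rfl, fun _ => mul_mem (inv_mem hx) hy⟩
  · rw [hψ' x (hle hx)]; exact heq (show (⟨x, hle hx⟩ : F (k + 1)) ∈ _ from hx)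

theorem exists_isLabelling_zero {F : ℕ → Subgroup G} (hfin : Finite (F 0)) :
    ∃ φ : G → ℕ, IsLabelling F 0 φ := by
  classical
  have e := Finite.equivFin (F 0)
  set φ : G → ℕ := fun x => if hx : x ∈ F 0 then e ⟨x, hx⟩ else 0
  have hφ : ∀ x (hx : x ∈ F 0), φ x = e ⟨x, hx⟩ := fun x hx => dif_pos hx
  have hlt : ∀ x ∈ F 0, φ x < Nat.card (F 0) := fun x hx => by rw [hφ x hx]; exact (e _).2
  refine ⟨φ, fun x hx y hy hxy => ?_, hlt, fun j hj x hx y hy => ?_⟩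
  · rw [hφ x hx, hφ y hy] at hxy
    exact congrArg Subtype.val (e.injective (Fin.ext hxy))
  · obtain rfl := Nat.le_zero.mp hj
    rw [Nat.div_eq_of_lt (hlt x hx), Nat.div_eq_of_lt (hlt y hy)]
    exact ⟨fun _ => rfl, fun _ => mul_mem (inv_mem hx) hy⟩

/-- An exhaustion of a group by an increasing sequence of finite subgroups. -/
structure IsExhaustion (F : ℕ → Subgroup G) : Prop where
  mono : Monotone F
  finite : ∀ k, Finite (F k)
  exists_mem : ∀ x, ∃ k, x ∈ F k

theorem LocallyFiniteGroup.exists_isExhaustion [Countable G] (h : LocallyFiniteGroup G) :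
    ∃ F : ℕ → Subgroup G, IsExhaustion F := by
  obtain ⟨γ, hγ⟩ := exists_surjective_nat G
  refine ⟨fun n => Subgroup.closure (γ '' Set.Iio n), fun m n hmn => ?_, fun k => h _ ?_,
    fun x => ?_⟩
  · exact Subgroup.closure_mono (Set.image_mono (Set.Iio_subset_Iio hmn))
  · exact (Subgroup.fg_iff _).mpr ⟨_, rfl, (Set.finite_Iio k).image γ⟩
  · obtain ⟨n, rfl⟩ := hγ x
    exact ⟨n + 1, Subgroup.subset_closure ⟨n, n.lt_succ_self, rfl⟩⟩

theorem IsExhaustion.exists_subset {F : ℕ → Subgroup G} (hF : IsExhaustion F) {S : Set G}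
    (hS : S.Finite) : ∃ k, S ⊆ F k := by
  choose κ hκ using hF.exists_mem
  obtain ⟨N, hN⟩ := (hS.image κ).bddAbove
  exact ⟨N, fun x hx => hF.mono (hN ⟨x, hx, rfl⟩) (hκ x)⟩

/-- A locally finite group can be numbered so that, for all members `F j` of an exhaustion by
finite subgroups, the left cosets of `F j` are the blocks of length `|F j|`. -/
theorem IsExhaustion.exists_labelling {F : ℕ → Subgroup G} (hF : IsExhaustion F) :
    ∃ φ : G → ℕ, Function.Injective φ ∧ (∀ n, n ∈ Set.range φ ↔ ∃ k, n < Nat.card (F k)) ∧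
      ∀ j x y, x⁻¹ * y ∈ F j ↔ φ x / Nat.card (F j) = φ y / Nat.card (F j) := by
  have hfin := hF.finite
  obtain ⟨φ₀, hφ₀⟩ := exists_isLabelling_zero (hfin 0)
  -- Each labelling extends the previous one on `F k`, so the label of a point is constant once the
  -- point has entered the exhaustion.
  let Φ : ∀ k, {φ : G → ℕ // IsLabelling F k φ} := fun k => Nat.rec ⟨φ₀, hφ₀⟩
    (fun k φ => ⟨(φ.2.exists_succ hF.mono hF.finite).choose,
      (φ.2.exists_succ hF.mono hF.finite).choose_spec.1⟩) k
  have hΦ : ∀ k, Set.EqOn (Φ (k + 1)).1 (Φ k).1 (F k) := fun k =>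
    ((Φ k).2.exists_succ hF.mono hF.finite).choose_spec.2
  have hΦle : ∀ k l, k ≤ l → Set.EqOn (Φ l).1 (Φ k).1 (F k) := fun k l hkl => by
    induction l, hkl using Nat.le_induction with
    | base => exact fun _ _ => rfl
    | succ l hkl ih => exact fun x hx => (hΦ l (hF.mono hkl hx)).trans (ih hx)
  choose κ hκ using hF.exists_mem
  set φ : G → ℕ := fun x => (Φ (κ x)).1 x
  have hφ : ∀ k x, x ∈ F k → φ x = (Φ k).1 x := fun k x hx => by
    rcases le_total k (κ x) with h | h
    · exact hΦle _ _ h hx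
    · exact (hΦle _ _ h (hκ x)).symm
  have hcommon : ∀ j x y, ∃ k, j ≤ k ∧ x ∈ F k ∧ y ∈ F k := fun j x y =>
    ⟨max j (max (κ x) (κ y)), le_max_left _ _,
      hF.mono ((le_max_left _ _).trans (le_max_right _ _)) (hκ x),
      hF.mono ((le_max_right _ _).trans (le_max_right _ _)) (hκ y)⟩
  refine ⟨φ, fun x y hxy => ?_, fun n => ⟨?_, ?_⟩, fun j x y => ?_⟩
  · obtain ⟨k, -, hx, hy⟩ := hcommon 0 x y
    rw [hφ k x hx, hφ k y hy] at hxy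
    exact (Φ k).2.injOn hx hy hxy
  · rintro ⟨x, rfl⟩
    exact ⟨κ x, (Φ (κ x)).2.lt x (hκ x)⟩
  · rintro ⟨k, hk⟩
    -- All numbers below `|F k|` occur as labels by counting. The range of the labelling thus
    -- depends on the orders alone, which allows labels of two groups to be matched.
    have hbij : Function.Bijective
        (fun x : F k => (⟨(Φ k).1 x, (Φ k).2.lt x x.2⟩ : Fin (Nat.card (F k)))) :=
      (Nat.bijective_iff_injective_and_card _).mpr
        ⟨fun x y hxy => Subtype.ext ((Φ k).2.injOn x.2 y.2 (congrArg Fin.val hxy)), by simp⟩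
    obtain ⟨x, hx⟩ := hbij.2 ⟨n, hk⟩
    exact ⟨x, (hφ k x x.2).trans (congrArg Fin.val hx)⟩
  · obtain ⟨k, hj, hx, hy⟩ := hcommon j x y
    rw [hφ k x hx, hφ k y hy]
    exact (Φ k).2.block j hj x hx y hy

end Labelling

/-! ### Coarse equivalences of locally finite groups -/

/-- When `|F k|` divides `|F' j|`, blocks of the first length nest in blocks of the second, so a
label-preserving map sends left cosets of `F k` into left cosets of `F' j`. -/
theorem exists_mem_of_card_dvd {G G' : Type*} [Group G] [Group G']
    {F : ℕ → Subgroup G} {F' : ℕ → Subgroup G'} {φ : G → ℕ} {φ' : G' → ℕ}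
    (hφ : ∀ j x y, x⁻¹ * y ∈ F j ↔ φ x / Nat.card (F j) = φ y / Nat.card (F j))
    (hφ' : ∀ j x y, x⁻¹ * y ∈ F' j ↔ φ' x / Nat.card (F' j) = φ' y / Nat.card (F' j))
    (hdvd : ∀ k, ∃ j, Nat.card (F k) ∣ Nat.card (F' j)) {f : G → G'} (hf : ∀ x, φ' (f x) = φ x)
    (k : ℕ) : ∃ j, ∀ x y, x⁻¹ * y ∈ F k → (f x)⁻¹ * f y ∈ F' j := by
  obtain ⟨j, c, hc⟩ := hdvd k
  refine ⟨j, fun x y hxy => ?_⟩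
  rw [hφ', hf, hf, hc, ← Nat.div_div_eq_div_mul, ← Nat.div_div_eq_div_mul, (hφ k x y).mp hxy]

section CoarseGroups

variable {G G' : Type*} [Group G] [Group G'] [MetricSpace G] [MetricSpace G']

theorem IsExhaustion.exists_closedBall_subset {F : ℕ → Subgroup G} (hF : IsExhaustion F)
    (hp : ProperDiscreteMetric G) (R : ℝ) : ∃ k, Metric.closedBall 1 R ⊆ (F k : Set G) :=
  hF.exists_subset (hp _ Metric.isClosed_closedBall Metric.isBounded_closedBall)

theorem LeftInvariantMetric.dist_one (hi : LeftInvariantMetric G) (x y : G) :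
    dist (x⁻¹ * y) 1 = dist x y := by
  have := hi x (x⁻¹ * y) 1
  rwa [mul_inv_cancel_left, mul_one, dist_comm y x, eq_comm] at this

/-- By left-invariance and properness, `dist x y ≤ R` puts `x⁻¹ * y` into a finite ball, hence into
some `F k`; conversely the finite subgroup `F' j` is bounded. -/
theorem bornologous_of_mem {F : ℕ → Subgroup G} {F' : ℕ → Subgroup G'} (hF : IsExhaustion F)
    (hF' : IsExhaustion F') (hp : ProperDiscreteMetric G) (hi : LeftInvariantMetric G)
    (hi' : LeftInvariantMetric G') {f : G → G'}
    (hf : ∀ k, ∃ j, ∀ x y, x⁻¹ * y ∈ F k → (f x)⁻¹ * f y ∈ F' j) : Bornologous f := by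
  intro R _
  obtain ⟨k, hk⟩ := hF.exists_closedBall_subset hp R
  obtain ⟨j, hj⟩ := hf k
  have := hF'.finite j
  obtain ⟨S, hS⟩ := ((Set.toFinite (F' j : Set G')).image (fun g => dist g 1)).bddAbove
  refine ⟨max S 1, by positivity, fun x y hxy => ?_⟩
  rw [← hi'.dist_one]
  refine le_trans (hS ⟨_, hj x y (hk ?_), rfl⟩) (le_max_left _ _)
  rwa [Metric.mem_closedBall, hi.dist_one]

theorem bijectivelyCoarselyEquivalent_of_card_dvd {F : ℕ → Subgroup G} {F' : ℕ → Subgroup G'}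
    (hF : IsExhaustion F) (hF' : IsExhaustion F') (hp : ProperDiscreteMetric G)
    (hp' : ProperDiscreteMetric G') (hi : LeftInvariantMetric G) (hi' : LeftInvariantMetric G')
    (hdvd : ∀ k, ∃ j, Nat.card (F k) ∣ Nat.card (F' j))
    (hdvd' : ∀ k, ∃ j, Nat.card (F' k) ∣ Nat.card (F j)) : BijectivelyCoarselyEquivalent G G' := by
  obtain ⟨φ, hinj, hran, hφ⟩ := hF.exists_labelling
  obtain ⟨φ', hinj', hran', hφ'⟩ := hF'.exists_labelling
  have hfin := hF.finite
  have hfin' := hF'.finite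
  have hrr : ∀ n, n ∈ Set.range φ ↔ n ∈ Set.range φ' := fun n => by
    rw [hran, hran']
    constructor
    · rintro ⟨k, hk⟩
      obtain ⟨j, hj⟩ := hdvd k
      exact ⟨j, hk.trans_le (Nat.le_of_dvd Nat.card_pos hj)⟩
    · rintro ⟨k, hk⟩
      obtain ⟨j, hj⟩ := hdvd' k
      exact ⟨j, hk.trans_le (Nat.le_of_dvd Nat.card_pos hj)⟩
  choose f hf using fun x => (hrr _).mp (Set.mem_range_self (f := φ) x)
  choose g hg using fun x => (hrr _).mpr (Set.mem_range_self (f := φ') x)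
  have hfg : ∀ y, f (g y) = y := fun y => hinj' (by rw [hf, hg])
  have hgf : ∀ x, g (f x) = x := fun x => hinj (by rw [hg, hf])
  refine ⟨f, ⟨?_, g, ?_, ⟨0, fun y => ?_⟩, ⟨0, fun x => ?_⟩⟩,
    Function.bijective_iff_has_inverse.mpr ⟨g, hgf, hfg⟩⟩
  · exact bornologous_of_mem hF hF' hp hi hi' (exists_mem_of_card_dvd hφ hφ' hdvd hf)
  · exact bornologous_of_mem hF' hF hp' hi' hi (exists_mem_of_card_dvd hφ' hφ hdvd' hg)
  · simp [hfg]
  · simp [hgf]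

end CoarseGroups

/-! ### Functoriality of `K₀` -/

section Functoriality

variable {A B : Type*} [Ring A] [StarRing A] [Ring B] [StarRing B]

theorem map_isStarProjection (f : A →⋆ₙ+* B) {m : Type} [Fintype m] {p : Matrix m m A}
    (hp : IsStarProjection p) : IsStarProjection (p.map f) := by
  have h1 : p.conjTranspose = p := hp.isSelfAdjoint
  have h2 : p * p = p := hp.isIdempotentElem
  refine ⟨?_, ?_⟩
  · change p.map f * p.map f = p.map f
    rw [← Matrix.map_mul, h2]
  · change (p.map f).conjTranspose = p.map f
    rw [← Matrix.conjTranspose_map f (fun a => map_star f a), h1]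

theorem MvN.map (f : A →⋆ₙ+* B) {m n : Type} [Fintype m] [Fintype n] {p : Matrix m m A}
    {q : Matrix n n A} (h : MvN p q) : MvN (p.map f) (q.map f) := by
  obtain ⟨v, rfl, rfl⟩ := h
  refine ⟨v.map f, ?_, ?_⟩ <;>
  rw [← Matrix.conjTranspose_map f (fun a => map_star f a), Matrix.map_mul]

/-- The entrywise image of a matrix projection under a `*`-homomorphism. -/
def MatrixProjection.map (f : A →⋆ₙ+* B) (p : MatrixProjection A) : MatrixProjection B :=
  ⟨p.1, p.2.1.map f, map_isStarProjection f p.2.2⟩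

theorem reindex_blockSum_map (f : A →⋆ₙ+* B) {l m n : Type} (e : m ⊕ n ≃ l)
    (p : Matrix m m A) (q : Matrix n n A) :
    (Matrix.reindex e e (blockSum p q)).map f =
      Matrix.reindex e e (blockSum (p.map f) (q.map f)) := by
  ext i j
  simp only [Matrix.map_apply, Matrix.reindex_apply, Matrix.submatrix_apply, blockSum]
  rcases e.symm i with _ | _ <;> rcases e.symm j with _ | _ <;> simp

theorem MatrixProjection.map_sum (f : A →⋆ₙ+* B) (p q : MatrixProjection A) :
    (p.sum q).map f = (p.map f).sum (q.map f) :=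
  Sigma.ext rfl (heq_of_eq (Subtype.ext (reindex_blockSum_map f _ _ _)))

/-- The homomorphism of Murray-von Neumann semigroups induced by a `*`-homomorphism. -/
def MvNSemigroup.map (f : A →⋆ₙ+* B) : MvNSemigroup A →+ MvNSemigroup B where
  toFun := Quotient.map (MatrixProjection.map f) (fun _ _ h => MvN.map f h)
  map_zero' := by
    refine congrArg MvNSemigroup.mk (Sigma.ext rfl (heq_of_eq (Subtype.ext ?_)))
    ext i; exact i.elim0
  map_add' a b := by
    induction a using Quotient.inductionOn with | _ p => ?_
    induction b using Quotient.inductionOn with | _ q => ?_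
    exact congrArg MvNSemigroup.mk (MatrixProjection.map_sum f p q)

/-- The homomorphism of `K₀`-groups induced by a `*`-homomorphism. -/
noncomputable def K0.map (f : A →⋆ₙ+* B) : K0 A →+ K0 B :=
  Algebra.GrothendieckAddGroup.lift (Algebra.GrothendieckAddGroup.of.comp (MvNSemigroup.map f))

theorem K0.lift_of {M N : Type*} [AddCommMonoid M] [AddCommGroup N] (f : M →+ N) (m : M) :
    Algebra.GrothendieckAddGroup.lift f (Algebra.GrothendieckAddGroup.of m) = f m :=
  DFunLike.congr_fun (Algebra.GrothendieckAddGroup.lift.symm_apply_apply f) m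

theorem K0.map_cls (f : A →⋆ₙ+* B) (p : MatrixProjection A) :
    K0.map f (K0.cls p) = K0.cls (p.map f) :=
  K0.lift_of _ _

theorem K0.hom_ext {N : Type*} [AddCommGroup N] {f g : K0 A →+ N}
    (h : ∀ p, f (K0.cls p) = g (K0.cls p)) : f = g := by
  refine Algebra.GrothendieckAddGroup.lift.symm.injective (AddMonoidHom.ext fun a => ?_)
  induction a using Quotient.inductionOn with | _ p => exact h p

theorem MatrixProjection.map_map_of_leftInverse {f : A →⋆ₙ+* B} {g : B →⋆ₙ+* A}
    (h : ∀ a, g (f a) = a) (p : MatrixProjection A) : (p.map f).map g = p := by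
  refine Sigma.ext rfl (heq_of_eq (Subtype.ext ?_))
  ext i j; exact h _

theorem K0.map_map_of_leftInverse {f : A →⋆ₙ+* B} {g : B →⋆ₙ+* A} (h : ∀ a, g (f a) = a)
    (x : K0 A) : K0.map g (K0.map f x) = x := by
  refine DFunLike.congr_fun (f := (K0.map g).comp (K0.map f)) (g := AddMonoidHom.id _)
    (K0.hom_ext fun p => ?_) x
  rw [AddMonoidHom.comp_apply, K0.map_cls, K0.map_cls,
    MatrixProjection.map_map_of_leftInverse h]; rfl

theorem orderedK0Iso_of_starAlgEquiv {R : Type*} [CommSemiring R] [Algebra R A] [Algebra R B]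
    (e : A ≃⋆ₐ[R] B) : OrderedK0Iso A B := by
  let f : A →⋆ₙ+* B := (e : A →⋆ₙ+* B)
  let g : B →⋆ₙ+* A := (e.symm : B →⋆ₙ+* A)
  have hgf : ∀ a, g (f a) = a := e.symm_apply_apply
  have hfg : ∀ b, f (g b) = b := e.apply_symm_apply
  refine ⟨{ K0.map f with
      invFun := K0.map g
      left_inv := K0.map_map_of_leftInverse hgf
      right_inv := K0.map_map_of_leftInverse hfg }, ?_, ?_⟩
  · ext x
    constructor
    · rintro ⟨_, ⟨p, rfl⟩, rfl⟩
      exact ⟨p.map f, (K0.map_cls f p).symm⟩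
    · rintro ⟨p, rfl⟩
      refine ⟨_, ⟨p.map g, rfl⟩, (K0.map_cls f _).trans ?_⟩
      rw [MatrixProjection.map_map_of_leftInverse hfg]
  -- The induced map on `K0` comes from a non-unital homomorphism; only here is it needed that `e`
  -- preserves 1.
  · refine (K0.map_cls f _).trans (congrArg K0.cls (Sigma.ext rfl (heq_of_eq (Subtype.ext ?_))))
    exact Matrix.map_one f (map_zero f) (map_one e)

theorem OrderedK0Iso.pointedK0Iso (h : OrderedK0Iso A B) : PointedK0Iso A B :=
  let ⟨φ, _, h⟩ := h
  ⟨φ, h⟩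

/-! ### Divisibility of the class of the unit -/

theorem isStarProjection_diagonal {e : A} (he : IsStarProjection e) (n : ℕ) :
    IsStarProjection (Matrix.diagonal fun _ : Fin n => e) := by
  refine ⟨?_, ?_⟩
  · change Matrix.diagonal _ * Matrix.diagonal _ = Matrix.diagonal _
    rw [Matrix.diagonal_mul_diagonal, he.isIdempotentElem]
  · change (Matrix.diagonal _).conjTranspose = Matrix.diagonal _
    rw [Matrix.diagonal_conjTranspose]
    exact congrArg Matrix.diagonal (funext fun _ => he.isSelfAdjoint)

/-- The projection `diag(e, …, e)` in `M_n(A)`. -/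
def MatrixProjection.diag {e : A} (he : IsStarProjection e) (n : ℕ) : MatrixProjection A :=
  ⟨n, Matrix.diagonal fun _ => e, isStarProjection_diagonal he n⟩

theorem reindex_blockSum_diagonal {A : Type*} [Ring A] {l m n : Type} [DecidableEq l]
    [DecidableEq m] [DecidableEq n] (σ : m ⊕ n ≃ l) (e : A) :
    Matrix.reindex σ σ (blockSum (Matrix.diagonal fun _ => e) (Matrix.diagonal fun _ => e)) =
      Matrix.diagonal fun _ => e := by
  rw [blockSum, Matrix.fromBlocks_diagonal, Matrix.reindex_apply, Matrix.submatrix_diagonal_equiv]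
  congr 1
  funext i
  change Sum.elim _ _ (σ.symm i) = e
  rcases σ.symm i with _ | _ <;> rfl

theorem MvNSemigroup.mk_diag {e : A} (he : IsStarProjection e) (n : ℕ) :
    mk (MatrixProjection.diag he n) = n • mk (MatrixProjection.diag he 1) := by
  induction n with
  | zero =>
    rw [zero_smul]
    refine congrArg mk (Sigma.ext rfl (heq_of_eq (Subtype.ext ?_)))
    ext i; exact i.elim0
  | succ n ih =>
    rw [succ_nsmul, ← ih, mk_add]
    exact congrArg mk
      (Sigma.ext rfl (heq_of_eq (Subtype.ext (reindex_blockSum_diagonal finSumFinEquiv e).symm)))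

/-- The column is read as an `n × 1` matrix; the two hypotheses compute its two products with its
adjoint. -/
theorem mvN_one_diagonal {e : A} {n : ℕ} (v : Fin n → A) (h1 : ∑ i, star (v i) * v i = 1)
    (h2 : ∀ i j, v i * star (v j) = if i = j then e else 0) :
    MvN (1 : Matrix (Fin 1) (Fin 1) A) (Matrix.diagonal fun _ : Fin n => e) := by
  refine ⟨Matrix.of fun i _ => v i, ?_, ?_⟩
  · ext i j
    rw [Subsingleton.elim j i, Matrix.mul_apply, Matrix.one_apply_eq, ← h1]; rfl
  · ext i j
    rw [Matrix.mul_apply, Fin.sum_univ_one, Matrix.diagonal_apply]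
    exact h2 i j

/-- If a column `v` with entries in `A` satisfies `v* v = 1` and `v v* = diag(e, …, e)`, then the
class of the unit is divisible by the length of the column. -/
theorem K0.exists_nsmul_eq_unit {e : A} (he : IsStarProjection e) {n : ℕ} (v : Fin n → A)
    (h1 : ∑ i, star (v i) * v i = 1) (h2 : ∀ i j, v i * star (v j) = if i = j then e else 0) :
    ∃ x : K0 A, n • x = K0.unit A := by
  refine ⟨K0.cls (MatrixProjection.diag he 1), ?_⟩
  have h : MvNSemigroup.mk (MatrixProjection.diag he n) =
      MvNSemigroup.mk (⟨1, 1, IsStarProjection.one _⟩ : MatrixProjection A) :=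
    Quotient.sound (mvN_one_diagonal v h1 h2).symm
  unfold K0.unit K0.cls
  rw [← h, MvNSemigroup.mk_diag he n, map_nsmul]

end Functoriality
/-! ### Bijections of the underlying sets -/

section Bijections

variable {X Y : Type*}

/-- The unitary `ℓ²(X) → ℓ²(Y)` induced by a bijection `X ≃ Y`. -/
noncomputable def permutationUnitary (σ : X ≃ Y) : Ell2 X ≃ₗᵢ[ℂ] Ell2 Y where
  toFun ξ := ⟨fun y => ξ (σ.symm y), memℓp_gen
    ((σ.symm.summable_iff (f := fun x => ‖ξ x‖ ^ (2 : ℝ≥0∞).toReal)).mpr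
      ((lp.memℓp ξ).summable (by norm_num)))⟩
  invFun ξ := ⟨fun x => ξ (σ x), memℓp_gen
    ((σ.summable_iff (f := fun x => ‖ξ x‖ ^ (2 : ℝ≥0∞).toReal)).mpr
      ((lp.memℓp ξ).summable (by norm_num)))⟩
  map_add' _ _ := by ext; rfl
  map_smul' _ _ := by ext; rfl
  left_inv ξ := by ext x; exact congrArg ξ (σ.symm_apply_apply x)
  right_inv ξ := by ext x; exact congrArg ξ (σ.apply_symm_apply x)
  norm_map' ξ := by
    have h2 : 0 < (2 : ℝ≥0∞).toReal := by norm_num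
    rw [lp.norm_eq_tsum_rpow h2, lp.norm_eq_tsum_rpow h2]
    congr 1
    exact σ.symm.tsum_eq (fun x => ‖ξ x‖ ^ (2 : ℝ≥0∞).toReal)

@[simp]
theorem permutationUnitary_apply (σ : X ≃ Y) (ξ : Ell2 X) (y : Y) :
    permutationUnitary σ ξ y = ξ (σ.symm y) := rfl

theorem delta_apply_self (x : X) : delta x x = (1 : ℂ) := by
  classical
  exact lp.single_apply_self (E := fun _ : X => ℂ) 2 x 1

theorem delta_apply_of_ne {x y : X} (h : y ≠ x) : delta x y = (0 : ℂ) := by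
  classical
  exact lp.single_apply_ne (E := fun _ : X => ℂ) 2 x 1 h

theorem delta_apply [DecidableEq X] (x y : X) : delta x y = if x = y then (1 : ℂ) else 0 := by
  split_ifs with h
  · rw [h, delta_apply_self]
  · rw [delta_apply_of_ne (Ne.symm h)]

theorem permutationUnitary_delta (σ : X ≃ Y) (x : X) :
    permutationUnitary σ (delta x) = delta (σ x) := by
  classical
  ext y
  rw [permutationUnitary_apply, delta_apply, delta_apply]
  simp only [Equiv.eq_symm_apply]

theorem permutationUnitary_symm_delta (σ : X ≃ Y) (y : Y) :
    (permutationUnitary σ).symm (delta y) = delta (σ.symm y) := by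
  rw [LinearIsometryEquiv.symm_apply_eq, permutationUnitary_delta, σ.apply_symm_apply]

theorem conj_diagonalOperator (σ : X ≃ Y) (f : lp (fun _ : X => ℂ) ∞) :
    ∃ g : lp (fun _ : Y => ℂ) ∞,
      (permutationUnitary σ).conjStarAlgEquiv (diagonalOperator f) = diagonalOperator g := by
  refine ⟨⟨fun y => f (σ.symm y), ?_⟩, ?_⟩
  · obtain ⟨C, hC⟩ := memℓp_infty_iff.mp (lp.memℓp f)
    exact memℓp_infty ⟨C, by rintro _ ⟨y, rfl⟩; exact hC ⟨σ.symm y, rfl⟩⟩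
  · ext ξ y
    change f (σ.symm y) * ξ (σ (σ.symm y)) = f (σ.symm y) * ξ y
    rw [σ.apply_symm_apply]

variable [MetricSpace X] [MetricSpace Y]

/-- The matrix coefficient of the conjugate at `(y, y')` is that of `T` at the preimages of `y` and
`y'`. -/
theorem FinitePropagation.conj {T : Ell2 X →L[ℂ] Ell2 X} (hT : FinitePropagation T) {σ : X ≃ Y}
    (hσ : Bornologous σ) : FinitePropagation ((permutationUnitary σ).conjStarAlgEquiv T) := by
  obtain ⟨R, hR, h⟩ := hT
  obtain ⟨S, hS, hRS⟩ := hσ R hR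
  refine ⟨S, hS, fun y y' hy => ?_⟩
  rw [LinearIsometryEquiv.conjStarAlgEquiv_apply_apply, permutationUnitary_symm_delta,
    inner_delta_left, permutationUnitary_apply, ← inner_delta_left]
  refine h _ _ (not_le.mp fun hle => ?_)
  have := hRS _ _ hle
  rw [σ.apply_symm_apply, σ.apply_symm_apply] at this
  exact absurd hy (not_lt.mpr this)

theorem conj_mem_uniformRoeAlgebra {σ : X ≃ Y} (hσ : Bornologous σ) {T : Ell2 X →L[ℂ] Ell2 X}
    (hT : T ∈ uniformRoeAlgebra X) :
    (permutationUnitary σ).conjStarAlgEquiv T ∈ uniformRoeAlgebra Y := by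
  have hc : Continuous ((permutationUnitary σ).conjStarAlgEquiv) := by
    change Continuous fun x : Ell2 X →L[ℂ] Ell2 X =>
      ((permutationUnitary σ : Ell2 X →L[ℂ] Ell2 Y) ∘L x) ∘L
        ((permutationUnitary σ).symm : Ell2 Y →L[ℂ] Ell2 X)
    fun_prop
  exact map_mem_closure hc hT fun S hS => FinitePropagation.conj hS hσ

/-- The isomorphism of uniform Roe algebras induced by a bijective coarse equivalence. -/
noncomputable def uniformRoeAlgebraEquiv (σ : X ≃ Y) (hσ : Bornologous σ)
    (hσ' : Bornologous σ.symm) : uniformRoeAlgebra X ≃⋆ₐ[ℂ] uniformRoeAlgebra Y where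
  toFun T := ⟨_, conj_mem_uniformRoeAlgebra hσ T.2⟩
  invFun T := ⟨_, conj_mem_uniformRoeAlgebra hσ' T.2⟩
  left_inv T := Subtype.ext (by
    ext ξ x
    change (T : Ell2 X →L[ℂ] Ell2 X) ((permutationUnitary σ).symm (permutationUnitary σ ξ))
      (σ.symm (σ x)) = (T : Ell2 X →L[ℂ] Ell2 X) ξ x
    rw [σ.symm_apply_apply, LinearIsometryEquiv.symm_apply_apply])
  right_inv T := Subtype.ext (by
    ext ξ x
    change (T : Ell2 Y →L[ℂ] Ell2 Y) (permutationUnitary σ ((permutationUnitary σ).symm ξ))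
      (σ (σ.symm x)) = (T : Ell2 Y →L[ℂ] Ell2 Y) ξ x
    rw [σ.apply_symm_apply, LinearIsometryEquiv.apply_symm_apply])
  map_mul' S T := Subtype.ext (map_mul (permutationUnitary σ).conjStarAlgEquiv S.1 T.1)
  map_add' S T := Subtype.ext (map_add (permutationUnitary σ).conjStarAlgEquiv S.1 T.1)
  map_star' T := Subtype.ext (map_star (permutationUnitary σ).conjStarAlgEquiv T.1)
  map_smul' c T := Subtype.ext (map_smul (permutationUnitary σ).conjStarAlgEquiv c T.1)

theorem uniformRoeAlgebraEquiv_image_ellInfty (σ : X ≃ Y) (hσ : Bornologous σ)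
    (hσ' : Bornologous σ.symm) :
    uniformRoeAlgebraEquiv σ hσ hσ' '' ellInfty X = ellInfty Y := by
  refine Set.Subset.antisymm ?_ fun T hT => ?_
  · rintro _ ⟨T, ⟨f, hf⟩, rfl⟩
    obtain ⟨g, hg⟩ := conj_diagonalOperator σ f
    exact ⟨g, by rw [← hg, ← hf]; rfl⟩
  · obtain ⟨f, hf⟩ := hT
    obtain ⟨g, hg⟩ := conj_diagonalOperator σ.symm f
    refine ⟨(uniformRoeAlgebraEquiv σ hσ hσ').symm T, ⟨g, ?_⟩,
      (uniformRoeAlgebraEquiv σ hσ hσ').apply_symm_apply T⟩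
    rw [← hg, ← hf]; rfl

/-- The inverse of a bijective coarse equivalence is bornologous. -/
theorem IsCoarseEquivalence.bornologous_symm {σ : X ≃ Y} (h : IsCoarseEquivalence σ) :
    Bornologous σ.symm := by
  obtain ⟨-, g, hg, -, C, hC⟩ := h
  intro R hR
  obtain ⟨S, hS, hRS⟩ := hg R hR
  refine ⟨S + 2 * max C 0, by positivity, fun y y' hy => ?_⟩
  -- The true inverse is close to the coarse inverse `g`; the triangle inequality uses this at both
  -- ends, whence the summand `2 * max C 0`. The maximum keeps the constant nonnegative.
  have key : ∀ z, dist (g z) (σ.symm z) ≤ max C 0 := fun z => by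
    have := hC (σ.symm z)
    simp only [Function.comp_apply, σ.apply_symm_apply, id] at this
    exact this.trans (le_max_left _ _)
  have h1 := dist_triangle4 (σ.symm y) (g y) (g y') (σ.symm y')
  have h2 := key y
  rw [dist_comm] at h2
  linarith [hRS y y' hy, key y']

theorem BijectivelyCoarselyEquivalent.exists_starAlgEquiv
    (h : BijectivelyCoarselyEquivalent X Y) :
    ∃ φ : uniformRoeAlgebra X ≃⋆ₐ[ℂ] uniformRoeAlgebra Y, φ '' ellInfty X = ellInfty Y := by
  obtain ⟨f, hf, hbij⟩ := h
  obtain ⟨σ, rfl⟩ : ∃ σ : X ≃ Y, ⇑σ = f := ⟨Equiv.ofBijective f hbij, rfl⟩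
  exact ⟨_, uniformRoeAlgebraEquiv_image_ellInfty σ hf.1 hf.bornologous_symm⟩

end Bijections
/-! ### Indicator operators and translations -/

section Indicator

variable {X : Type*}

/-- The diagonal projection onto the functions supported on `S`. -/
noncomputable def indicatorOp (S : Set X) : Ell2 X →L[ℂ] Ell2 X :=
  diagonalOperator ⟨S.indicator 1, memℓp_infty ⟨1, by
    rintro _ ⟨x, rfl⟩
    by_cases h : x ∈ S <;> simp [h]⟩⟩

theorem indicatorOp_apply (S : Set X) (ξ : Ell2 X) (x : X) [Decidable (x ∈ S)] :
    indicatorOp S ξ x = if x ∈ S then ξ x else 0 := by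
  change S.indicator (1 : X → ℂ) x * ξ x = _
  by_cases h : x ∈ S <;> simp [h]

theorem isStarProjection_indicatorOp (S : Set X) : IsStarProjection (indicatorOp S) := by
  classical
  refine ⟨?_, ?_⟩
  · ext ξ x
    change indicatorOp S (indicatorOp S ξ) x = _
    simp only [indicatorOp_apply]
    split_ifs <;> rfl
  · rw [ContinuousLinearMap.isSelfAdjoint_iff_isSymmetric]
    intro ξ η
    change inner ℂ (indicatorOp S ξ) η = inner ℂ ξ (indicatorOp S η)
    rw [lp.inner_eq_tsum, lp.inner_eq_tsum]
    refine tsum_congr fun x => ?_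
    rw [indicatorOp_apply, indicatorOp_apply]
    split_ifs <;> simp

theorem sum_indicatorOp {ι : Type*} [Fintype ι] {S : ι → Set X} (hS : ∀ x, ∃! i, x ∈ S i) :
    ∑ i, indicatorOp (S i) = 1 := by
  classical
  ext ξ x
  obtain ⟨i, hi, huniq⟩ := hS x
  rw [sum_apply, lp.coeFn_sum, Finset.sum_apply, Finset.sum_eq_single i]
  · rw [indicatorOp_apply, if_pos hi]; rfl
  · intro j _ hj
    rw [indicatorOp_apply, if_neg fun h => hj (huniq j h)]
  · exact fun h => absurd (Finset.mem_univ _) h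

theorem indicatorOp_mem [MetricSpace X] (S : Set X) : indicatorOp S ∈ uniformRoeAlgebra X := by
  classical
  refine subset_closure ⟨1, one_pos, fun x x' hx => ?_⟩
  have hne : x' ≠ x := by
    rintro rfl
    rw [dist_self] at hx
    linarith
  rw [inner_delta_left, indicatorOp_apply, delta_apply, if_neg hne, ite_self]

end Indicator

section Translations

variable {G : Type*} [Group G]

/-- The operator `ξ ↦ (x ↦ ξ (x * s⁻¹))`. -/
noncomputable def translationOp (s : G) : Ell2 G →L[ℂ] Ell2 G :=
  (permutationUnitary (Equiv.mulRight s) : Ell2 G →L[ℂ] Ell2 G)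

@[simp]
theorem translationOp_apply (s : G) (ξ : Ell2 G) (x : G) :
    translationOp s ξ x = ξ (x * s⁻¹) := rfl

theorem star_translationOp (s : G) : star (translationOp s) = translationOp s⁻¹ := by
  rw [ContinuousLinearMap.star_eq_adjoint, translationOp, LinearIsometryEquiv.adjoint_eq_symm]
  ext ξ x
  change ξ (x * s) = ξ (x * s⁻¹⁻¹)
  rw [inv_inv]

/-- Left-invariance makes right translation by `s` move every point by the same distance `dist s 1`.
-/
theorem translationOp_mem [MetricSpace G] (hi : LeftInvariantMetric G) (s : G) :
    translationOp s ∈ uniformRoeAlgebra G := by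
  classical
  refine subset_closure ⟨max (dist s 1) 1, by positivity, fun x x' hx => ?_⟩
  rw [inner_delta_left, translationOp_apply, delta_apply, if_neg]
  rintro rfl
  have := hi (x * s⁻¹) s 1
  rw [inv_mul_cancel_right, mul_one] at this
  rw [this] at hx
  exact absurd hx (not_lt.mpr (le_max_left _ _))

theorem indicatorOp_mul_translationOp_apply (T : Set G) (s : G) (ξ : Ell2 G)
    (x : G) [Decidable (x ∈ T)] :
    (indicatorOp T * translationOp s) ξ x = if x ∈ T then ξ (x * s⁻¹) else 0 := by
  exact indicatorOp_apply T (translationOp s ξ) x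

theorem star_indicatorOp_mul_translationOp_apply (T : Set G) (s : G) (ξ : Ell2 G)
    (x : G) [Decidable (x * s ∈ T)] :
    star (indicatorOp T * translationOp s) ξ x = if x * s ∈ T then ξ (x * s) else 0 := by
  rw [star_mul, star_translationOp, (isStarProjection_indicatorOp T).isSelfAdjoint.star_eq]
  change indicatorOp T ξ (x * s⁻¹⁻¹) = _
  rw [inv_inv, indicatorOp_apply]

theorem star_mul_self_indicatorOp_mul_translationOp (T : Set G) (s : G) :
    star (indicatorOp T * translationOp s) * (indicatorOp T * translationOp s) =
      indicatorOp {x | x * s ∈ T} := by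
  classical
  ext ξ x
  rw [mul_apply_eq_comp, star_indicatorOp_mul_translationOp_apply,
    indicatorOp_mul_translationOp_apply, indicatorOp_apply, mul_inv_cancel_right]
  by_cases hx : x * s ∈ T
  · rw [if_pos hx, if_pos hx]; exact (if_pos hx).symm
  · rw [if_neg hx]; exact (if_neg hx).symm

theorem mul_star_indicatorOp_mul_translationOp_self (T : Set G) (s : G) :
    indicatorOp T * translationOp s * star (indicatorOp T * translationOp s) = indicatorOp T := by
  classical
  ext ξ x
  rw [mul_apply_eq_comp, indicatorOp_mul_translationOp_apply,
    star_indicatorOp_mul_translationOp_apply, inv_mul_cancel_right, indicatorOp_apply]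
  split_ifs <;> rfl

/-- The product can be nonzero at `x` only if both `x` and `x * (s⁻¹ * t)` lie in `T`. -/
theorem mul_star_indicatorOp_mul_translationOp_eq_zero {T : Set G} {s t : G}
    (h : ∀ x ∈ T, x * (s⁻¹ * t) ∉ T) :
    indicatorOp T * translationOp s * star (indicatorOp T * translationOp t) = 0 := by
  classical
  ext ξ x
  rw [mul_apply_eq_comp, indicatorOp_mul_translationOp_apply,
    star_indicatorOp_mul_translationOp_apply, mul_assoc]
  split_ifs with hx hx'
  · exact absurd hx' (h x hx)
  · rfl
  · rfl

/-- The order of a finite subgroup divides the class of the unit. -/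
theorem exists_card_nsmul_eq_unit [MetricSpace G] (hi : LeftInvariantMetric G) (F : Subgroup G)
    [Finite F] : ∃ x : K0 (uniformRoeAlgebra G), Nat.card F • x = K0.unit _ := by
  classical
  -- `T` is a transversal of the left cosets: each `x` has exactly one `s ∈ F` with `x * s ∈ T`.
  -- Hence the sets `{x | x * s ∈ T}` partition the group, and they are the initial supports of the
  -- partial isometries `v i`, which all have range projection `indicatorOp T`.
  let T : Set G := {x | (x : G ⧸ F).out = x}
  have hT : ∀ x : G, ∀ s ∈ F, x * s ∈ T ↔ s = x⁻¹ * (x : G ⧸ F).out := fun x s hs => by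
    change ((x * s : G) : G ⧸ F).out = x * s ↔ _
    rw [QuotientGroup.mk_mul_of_mem x hs, eq_inv_mul_iff_mul_eq, eq_comm]
  let e : Fin (Nat.card F) ≃ F := (Finite.equivFin F).symm
  let v : Fin (Nat.card F) → uniformRoeAlgebra G := fun i =>
    ⟨indicatorOp T * translationOp (e i : G),
      mul_mem (indicatorOp_mem T) (translationOp_mem hi _)⟩
  have he : IsStarProjection (⟨indicatorOp T, indicatorOp_mem T⟩ : uniformRoeAlgebra G) :=
    ⟨Subtype.ext (isStarProjection_indicatorOp T).isIdempotentElem,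
      Subtype.ext (isStarProjection_indicatorOp T).isSelfAdjoint⟩
  refine K0.exists_nsmul_eq_unit he v (Subtype.ext ?_) fun i j => Subtype.ext ?_
  · rw [AddSubmonoidClass.coe_finsetSum]
    refine (Finset.sum_congr rfl fun i _ =>
      star_mul_self_indicatorOp_mul_translationOp T (e i : G)).trans (sum_indicatorOp fun x => ?_)
    have hs : x⁻¹ * (x : G ⧸ F).out ∈ F := QuotientGroup.eq.mp (QuotientGroup.out_eq' _).symm
    refine ⟨e.symm ⟨_, hs⟩, ?_, fun i hi => e.eq_symm_apply.mpr (Subtype.ext ?_)⟩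
    · change x * (e (e.symm ⟨_, hs⟩) : G) ∈ T
      rw [e.apply_symm_apply]
      exact (hT x _ hs).mpr rfl
    · exact (hT x _ (e i).2).mp hi
  · split_ifs with hij
    · subst hij
      exact mul_star_indicatorOp_mul_translationOp_self T (e i : G)
    · refine mul_star_indicatorOp_mul_translationOp_eq_zero fun x hx hx' => hij ?_
      have h1 := (hT x 1 F.one_mem).mp (by rwa [mul_one])
      have h2 := (hT x _ (F.mul_mem (F.inv_mem (e i).2) (e j).2)).mp hx'
      rw [← h1, inv_mul_eq_one] at h2
      exact e.injective (Subtype.ext h2)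

end Translations

/-! ### Approximate projections -/

section ApproximateProjections

/-- A continuous function that vanishes below `1/4` and is `1` above `3/4`. -/
noncomputable def clip (t : ℝ) : ℝ := max 0 (min 1 (2 * t - 1 / 2))

theorem continuous_clip : Continuous clip := by unfold clip; fun_prop

theorem clip_one : clip 1 = 1 := by norm_num [clip]

theorem clip_of_le {t : ℝ} (h : t ≤ 1 / 4) : clip t = 0 :=
  max_eq_left ((min_le_right _ _).trans (by linarith))

theorem clip_of_ge {t : ℝ} (h : 3 / 4 ≤ t) : clip t = 1 := by
  rw [clip, min_eq_left (by linarith), max_eq_right zero_le_one]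

/-- On the open interval from 1/4 to 3/4 one has `t * (1 - t) > 3/16`; the spectrum of an
approximate projection therefore avoids the region where `clip` is neither 0 nor 1. -/
theorem le_or_ge_of_abs_sq_sub_le {t : ℝ} (h : |t * t - t| ≤ 3 / 16) : t ≤ 1 / 4 ∨ 3 / 4 ≤ t := by
  by_contra! hc
  have := neg_abs_le (t * t - t)
  nlinarith [mul_pos (sub_pos.mpr hc.1) (sub_pos.mpr hc.2)]

theorem clip_mul_clip {t : ℝ} (h : |t * t - t| ≤ 3 / 16) : clip t * clip t = clip t := by
  rcases le_or_ge_of_abs_sq_sub_le h with h | h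
  · rw [clip_of_le h, mul_zero]
  · rw [clip_of_ge h, mul_one]

/-- One of the factors of `|t| * |1 - t| ≤ δ` is at least 3/4, so the other, which is the rounding
error, is at most `4δ/3`. -/
theorem abs_clip_sub_le {t δ : ℝ} (h : |t * t - t| ≤ δ) (hδ : δ ≤ 3 / 16) :
    |clip t - t| ≤ 2 * δ := by
  have hfac : |t| * |1 - t| ≤ δ := by
    rwa [← abs_mul, ← abs_neg, show -(t * (1 - t)) = t * t - t by ring]
  rcases le_or_ge_of_abs_sq_sub_le (h.trans hδ) with ht | ht
  · rw [clip_of_le ht, zero_sub, abs_neg]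
    have : 3 / 4 ≤ |1 - t| := le_trans (by linarith) (le_abs_self _)
    nlinarith [abs_nonneg t]
  · rw [clip_of_ge ht]
    have : 3 / 4 ≤ |t| := ht.trans (le_abs_self _)
    nlinarith [abs_nonneg (1 - t)]

variable {A : Type*} [CStarAlgebra A] {a : A} {δ : ℝ}

theorem abs_mul_self_sub_le_of_mem_spectrum (ha : IsSelfAdjoint a) (h : ‖a * a - a‖ ≤ δ) {t : ℝ}
    (ht : t ∈ spectrum ℝ a) : |t * t - t| ≤ δ := by
  have h1 : cfc (fun t : ℝ => t * t - t) a = a * a - a := by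
    rw [cfc_sub (fun t : ℝ => t * t) (fun t => t) a, cfc_mul (fun t : ℝ => t) (fun t => t) a,
      cfc_id' ℝ a]
  rw [← h1] at h
  exact (norm_apply_le_norm_cfc (fun t : ℝ => t * t - t) a ht).trans h

theorem isStarProjection_cfc_clip (ha : IsSelfAdjoint a) (h : ‖a * a - a‖ ≤ 3 / 16) :
    IsStarProjection (cfc clip a) := by
  have hc := continuous_clip.continuousOn (s := spectrum ℝ a)
  refine ⟨?_, cfc_predicate clip a⟩
  change cfc clip a * cfc clip a = cfc clip a
  rw [← cfc_mul clip clip a hc hc]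
  exact cfc_congr fun t ht => clip_mul_clip (abs_mul_self_sub_le_of_mem_spectrum ha h ht)

theorem norm_cfc_clip_sub_le (ha : IsSelfAdjoint a) (h : ‖a * a - a‖ ≤ δ) (hδ : δ ≤ 3 / 16) :
    ‖cfc clip a - a‖ ≤ 2 * δ := by
  have hc := continuous_clip.continuousOn (s := spectrum ℝ a)
  have h1 : cfc (fun t : ℝ => clip t - t) a = cfc clip a - a := by
    rw [cfc_sub clip (fun t => t) a, cfc_id' ℝ a]
  rw [← h1]
  exact norm_cfc_le (by linarith [norm_nonneg (a * a - a)]) fun t ht =>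
    abs_clip_sub_le (abs_mul_self_sub_le_of_mem_spectrum ha h ht) hδ

end ApproximateProjections

/-! ### Ranks of nearby projections -/

section Ranks

open ContinuousLinearMap

/-- The rank of an operator on a finite-dimensional space. -/
noncomputable def opRank {E : Type*} [NormedAddCommGroup E] [InnerProductSpace ℂ E]
    (e : E →L[ℂ] E) : ℕ :=
  Module.finrank ℂ (e : E →ₗ[ℂ] E).range

theorem opRank_one {E : Type*} [NormedAddCommGroup E] [InnerProductSpace ℂ E] :
    opRank (1 : E →L[ℂ] E) = Module.finrank ℂ E := by
  have : ((1 : E →L[ℂ] E) : E →ₗ[ℂ] E) = LinearMap.id := rfl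
  rw [opRank, this, LinearMap.range_id, finrank_top]

theorem trace_eq_opRank {E : Type*} [NormedAddCommGroup E] [InnerProductSpace ℂ E]
    [FiniteDimensional ℂ E] {e : E →L[ℂ] E} (he : IsIdempotentElem e) :
    LinearMap.trace ℂ E e = opRank e := by
  have h : IsIdempotentElem (e : E →ₗ[ℂ] E) := congrArg toLinearMap he
  exact (LinearMap.IsIdempotentElem.isProj_range _ h).trace

theorem norm_inner_self_eq_norm_sq {E : Type*} [NormedAddCommGroup E] [InnerProductSpace ℂ E]
    (x : E) : ‖inner ℂ x x‖ = ‖x‖ ^ 2 := by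
  rw [inner_self_eq_norm_sq_to_K]
  simp

variable {E E' : Type*} [NormedAddCommGroup E] [InnerProductSpace ℂ E] [CompleteSpace E]
  [NormedAddCommGroup E'] [InnerProductSpace ℂ E'] [CompleteSpace E']

/-- If `v* v` is close to the projection `e` and `v v*` to the projection `e'`, then `e' v` is
injective on the range of `e`. -/
theorem eq_zero_of_norm_sub_le {e : E →L[ℂ] E} {e' : E' →L[ℂ] E'} {v : E →L[ℂ] E'}
    (h : ‖e - adjoint v ∘L v‖ ≤ 1 / 4) (h' : ‖e' - v ∘L adjoint v‖ ≤ 1 / 4) {x : E}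
    (hx : e x = x) (hx' : e' (v x) = 0) : x = 0 := by
  set w := adjoint v (v x) with hw
  have h1 : ‖x - w‖ ≤ 1 / 4 * ‖x‖ := by
    have := (e - adjoint v ∘L v).le_of_opNorm_le h x
    rwa [sub_apply, hx] at this
  have h2 : ‖v w‖ ≤ 1 / 4 * ‖v x‖ := by
    have := (e' - v ∘L adjoint v).le_of_opNorm_le h' (v x)
    rwa [sub_apply, hx', zero_sub, norm_neg] at this
  have h3 : ‖v x‖ ^ 2 ≤ ‖w‖ * ‖x‖ := by
    rw [← norm_inner_self_eq_norm_sq, ← adjoint_inner_left]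
    exact norm_inner_le_norm _ _
  have h4 : ‖w‖ ^ 2 ≤ ‖v w‖ * ‖v x‖ := by
    rw [← norm_inner_self_eq_norm_sq]
    nth_rw 2 [hw]
    rw [adjoint_inner_right]
    exact norm_inner_le_norm _ _
  have h5 : ‖x‖ ≤ ‖w‖ + 1 / 4 * ‖x‖ := by
    have := norm_add_le w (x - w)
    rw [add_sub_cancel] at this
    linarith
  have h6 : ‖w‖ ≤ ‖x‖ + 1 / 4 * ‖x‖ := by
    have := norm_sub_le x (x - w)
    rw [sub_sub_cancel] at this
    linarith
  -- Combining `h4`, `h2` and `h3` gives `‖w‖² ≤ ‖v x‖² / 4 ≤ ‖w‖ ‖x‖ / 4`, so `w` is short; but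
  -- `h1` makes `w` close to `x`, which leaves only `x = 0`.
  have h7 : ‖w‖ ^ 2 ≤ 1 / 4 * (‖w‖ * ‖x‖) := by nlinarith [norm_nonneg (v x)]
  have h8 : ‖w‖ ≤ 1 / 4 * ‖x‖ := by
    by_contra! hc
    nlinarith [norm_nonneg x, norm_nonneg w]
  have : ‖x‖ ≤ 0 := by linarith [norm_nonneg x]
  exact norm_le_zero_iff.mp this

variable [FiniteDimensional ℂ E']

theorem opRank_le_of_norm_sub_le {e : E →L[ℂ] E} {e' : E' →L[ℂ] E'} (he : IsIdempotentElem e)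
    (v : E →L[ℂ] E') (h : ‖e - adjoint v ∘L v‖ ≤ 1 / 4) (h' : ‖e' - v ∘L adjoint v‖ ≤ 1 / 4) :
    opRank e ≤ opRank e' := by
  -- The map `x ↦ e' (v x)` between the ranges is injective by the preceding estimate.
  let f : (e : E →ₗ[ℂ] E).range →ₗ[ℂ] (e' : E' →ₗ[ℂ] E').range :=
    ((e' : E' →ₗ[ℂ] E').rangeRestrict ∘ₗ (v : E →ₗ[ℂ] E')) ∘ₗ Submodule.subtype _
  refine LinearMap.finrank_le_finrank_of_injective (f := f)
    ((injective_iff_map_eq_zero f).mpr fun x hx => Subtype.ext ?_)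
  obtain ⟨y, hy⟩ := x.2
  refine eq_zero_of_norm_sub_le h h' (x := x) ?_ (congrArg Subtype.val hx)
  rw [← hy]
  exact DFunLike.congr_fun he y

variable [FiniteDimensional ℂ E]

/-- Projections that are approximately Murray-von Neumann equivalent have the same rank. -/
theorem opRank_eq_of_norm_sub_le {e : E →L[ℂ] E} {e' : E' →L[ℂ] E'} (he : IsIdempotentElem e)
    (he' : IsIdempotentElem e') (v : E →L[ℂ] E') (h : ‖e - adjoint v ∘L v‖ ≤ 1 / 4)
    (h' : ‖e' - v ∘L adjoint v‖ ≤ 1 / 4) : opRank e = opRank e' :=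
  (opRank_le_of_norm_sub_le he v h h').antisymm
    (opRank_le_of_norm_sub_le he' (adjoint v) (by rwa [adjoint_adjoint]) (by rwa [adjoint_adjoint]))

theorem opRank_eq_of_norm_sub_le' {e e' : E →L[ℂ] E} (he : IsStarProjection e)
    (he' : IsStarProjection e') (h : ‖e' - e‖ ≤ 1 / 4) : opRank e = opRank e' := by
  have h1 : adjoint e = e := he.isSelfAdjoint
  have h2 : e ∘L e = e := he.isIdempotentElem
  -- For nearby projections `v = e` serves as approximate partial isometry, since `e* e = e e* = e`.
  refine opRank_eq_of_norm_sub_le he.isIdempotentElem he'.isIdempotentElem e ?_ ?_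
  · rw [h1, h2, sub_self, norm_zero]; norm_num
  · rwa [h1, h2]

/-- The orthogonal sum of two projections on a common larger space, along coisometries with
orthogonal initial spaces. -/
theorem isStarProjection_orthogonal_sum {K : Type*} [NormedAddCommGroup K]
    [InnerProductSpace ℂ K] [FiniteDimensional ℂ K] [CompleteSpace K] {e : E →L[ℂ] E}
    {f : E' →L[ℂ] E'} (he : IsStarProjection e) (hf : IsStarProjection f) {w : K →L[ℂ] E}
    {w' : K →L[ℂ] E'} (h1 : w ∘L adjoint w = 1) (h2 : w' ∘L adjoint w' = 1)
    (h3 : w ∘L adjoint w' = 0) :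
    IsStarProjection (adjoint w ∘L e ∘L w + adjoint w' ∘L f ∘L w') ∧
      opRank (adjoint w ∘L e ∘L w + adjoint w' ∘L f ∘L w') = opRank e + opRank f := by
  have h4 : w' ∘L adjoint w = 0 := by
    rw [← adjoint_adjoint w', ← adjoint_comp, h3, map_zero]
  have h1' : ∀ x, w (adjoint w x) = x := DFunLike.congr_fun h1
  have h2' : ∀ x, w' (adjoint w' x) = x := DFunLike.congr_fun h2
  have h3' : ∀ x, w (adjoint w' x) = 0 := DFunLike.congr_fun h3
  have h4' : ∀ x, w' (adjoint w x) = 0 := DFunLike.congr_fun h4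
  have hee : ∀ x, e (e x) = e x := DFunLike.congr_fun he.isIdempotentElem
  have hff : ∀ x, f (f x) = f x := DFunLike.congr_fun hf.isIdempotentElem
  have hs : IsStarProjection (adjoint w ∘L e ∘L w + adjoint w' ∘L f ∘L w') := by
    refine ⟨?_, ?_⟩
    · ext x
      simp [h1', h2', h3', h4', hee, hff]
    · change adjoint _ = _
      rw [map_add, adjoint_comp, adjoint_comp, adjoint_comp, adjoint_comp, adjoint_adjoint,
        adjoint_adjoint, show adjoint e = e from he.isSelfAdjoint,
        show adjoint f = f from hf.isSelfAdjoint, comp_assoc, comp_assoc]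
  refine ⟨hs, ?_⟩
  -- Rank is trace for idempotents; cyclicity of the trace brings `w` next to its adjoint, where `w
  -- w* = 1` removes both.
  have ht := trace_eq_opRank hs.isIdempotentElem
  rw [toLinearMap_add, map_add, toLinearMap_comp, toLinearMap_comp (adjoint w'),
    LinearMap.trace_comp_comm', LinearMap.trace_comp_comm' ((f ∘L w' : K →L[ℂ] E') : K →ₗ[ℂ] E'),
    ← toLinearMap_comp, ← toLinearMap_comp, comp_assoc, comp_assoc, h1, h2] at ht
  have h5 : e ∘L (1 : E →L[ℂ] E) = e := rfl
  have h6 : f ∘L (1 : E' →L[ℂ] E') = f := rfl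
  rw [h5, h6, trace_eq_opRank he.isIdempotentElem, trace_eq_opRank hf.isIdempotentElem] at ht
  exact_mod_cast ht.symm

end Ranks

/-! ### Compressions to finite sets -/

section Compression

open ContinuousLinearMap InnerProductSpace

variable {X : Type*}

theorem inner_delta [DecidableEq X] (x y : X) :
    inner ℂ (delta x) (delta y) = if x = y then (1 : ℂ) else 0 := by
  rw [inner_delta_left, delta_apply]
  simp only [eq_comm]

theorem indicatorOp_eq_sum (S : Finset X) :
    indicatorOp (S : Set X) = ∑ g : S, rankOne ℂ (delta (g : X)) (delta (g : X)) := by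
  classical
  ext ξ x
  rw [indicatorOp_apply, sum_apply, lp.coeFn_sum, Finset.sum_apply]
  simp only [rankOne_apply, inner_delta_left, lp.coeFn_smul, Pi.smul_apply, delta_apply,
    smul_eq_mul, mul_ite, mul_one, mul_zero]
  by_cases hx : x ∈ S
  · rw [if_pos (Finset.mem_coe.mpr hx), Finset.sum_eq_single ⟨x, hx⟩]
    · simp
    · exact fun g _ hg => if_neg fun h => hg (Subtype.ext h)
    · exact fun h => absurd (Finset.mem_univ _) h
  · rw [if_neg (by simpa using hx), Finset.sum_eq_zero]
    rintro ⟨g, hg⟩ -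
    exact if_neg (by rintro rfl; exact hx hg)

theorem norm_one_sub_indicatorOp_mul_le (S : Set X) (T : Ell2 X →L[ℂ] Ell2 X) :
    ‖(1 - indicatorOp S) * T * indicatorOp S‖ ≤ ‖T‖ := by
  have h := isStarProjection_indicatorOp S
  have h1 := h.norm_le
  have h2 := h.one_sub.norm_le
  calc _ ≤ ‖1 - indicatorOp S‖ * ‖T‖ * ‖indicatorOp S‖ :=
        (norm_mul_le _ _).trans (mul_le_mul_of_nonneg_right (norm_mul_le _ _) (norm_nonneg _))
    _ ≤ 1 * ‖T‖ * 1 := by gcongr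
    _ = ‖T‖ := by ring

variable (S : Finset X) {ι κ μ : Type} [Fintype ι] [Fintype κ] [Fintype μ]

/-- The embedding of the `i`-th summand of `ℓ²(S)^ι` into `ℓ²(X)`. -/
noncomputable def blockEmb (i : ι) : EuclideanSpace ℂ (ι × S) →L[ℂ] Ell2 X :=
  ∑ g : S, rankOne ℂ (delta (g : X)) (EuclideanSpace.basisFun (ι × S) ℂ (i, g))

theorem adjoint_blockEmb (i : ι) : adjoint (blockEmb S i) =
    ∑ g : S, rankOne ℂ (EuclideanSpace.basisFun (ι × S) ℂ (i, g)) (delta (g : X)) := by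
  simp only [blockEmb, map_sum, adjoint_rankOne]

theorem blockEmb_comp_adjoint [DecidableEq ι] (i j : ι) :
    blockEmb S i ∘L adjoint (blockEmb S j) = if i = j then indicatorOp (S : Set X) else 0 := by
  classical
  rw [adjoint_blockEmb, blockEmb, indicatorOp_eq_sum]
  simp only [finsetSum_comp, comp_finsetSum, rankOne_comp_rankOne,
    orthonormal_iff_ite.mp (EuclideanSpace.basisFun (ι × S) ℂ).orthonormal, Prod.mk.injEq]
  split_ifs with h
  · simp [h]
  · simp [h]

theorem indicatorOp_comp_blockEmb (i : ι) :
    indicatorOp (S : Set X) ∘L blockEmb S i = blockEmb S i := by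
  classical
  rw [indicatorOp_eq_sum, blockEmb]
  simp only [finsetSum_comp, comp_finsetSum, rankOne_comp_rankOne, inner_delta]
  simp

theorem adjoint_blockEmb_comp_indicatorOp (i : ι) :
    adjoint (blockEmb S i) ∘L indicatorOp (S : Set X) = adjoint (blockEmb S i) := by
  have h : adjoint (indicatorOp (S : Set X)) = indicatorOp (S : Set X) :=
    (isStarProjection_indicatorOp _).isSelfAdjoint
  conv_lhs => rw [← h, ← adjoint_comp, indicatorOp_comp_blockEmb]

theorem sum_adjoint_blockEmb_comp :
    ∑ i : ι, adjoint (blockEmb S i) ∘L blockEmb S i = 1 := by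
  classical
  have h := (EuclideanSpace.basisFun (ι × S) ℂ).sum_rankOne_eq_id
  rw [Fintype.sum_prod_type] at h
  refine Eq.trans (Finset.sum_congr rfl fun i _ => ?_) h
  rw [adjoint_blockEmb, blockEmb]
  simp only [finsetSum_comp, comp_finsetSum, rankOne_comp_rankOne, inner_delta]
  simp

theorem norm_blockEmb_le (i : ι) : ‖blockEmb S i‖ ≤ 1 := by
  classical
  have h := norm_adjoint_comp_self (adjoint (blockEmb S i))
  rw [adjoint_adjoint, blockEmb_comp_adjoint, if_pos rfl, LinearIsometryEquiv.norm_map] at h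
  have h1 := (isStarProjection_indicatorOp (S : Set X)).norm_le
  nlinarith [norm_nonneg (blockEmb S i)]

/-- The compression to `S` of a matrix of operators. -/
noncomputable def compress (u : Matrix ι κ (Ell2 X →L[ℂ] Ell2 X)) :
    EuclideanSpace ℂ (κ × S) →L[ℂ] EuclideanSpace ℂ (ι × S) :=
  ∑ i, ∑ j, adjoint (blockEmb S i) ∘L u i j ∘L blockEmb S j

theorem compress_add (u v : Matrix ι κ (Ell2 X →L[ℂ] Ell2 X)) :
    compress S (u + v) = compress S u + compress S v := by
  simp only [compress, Matrix.add_apply, add_comp, comp_add, Finset.sum_add_distrib]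

theorem compress_sub (u v : Matrix ι κ (Ell2 X →L[ℂ] Ell2 X)) :
    compress S (u - v) = compress S u - compress S v := by
  simp only [compress, Matrix.sub_apply, sub_comp, comp_sub, Finset.sum_sub_distrib]

theorem compress_zero : compress S (0 : Matrix ι κ (Ell2 X →L[ℂ] Ell2 X)) = 0 := by
  simp [compress]

theorem compress_one [DecidableEq ι] :
    compress S (1 : Matrix ι ι (Ell2 X →L[ℂ] Ell2 X)) = 1 := by
  rw [compress, ← sum_adjoint_blockEmb_comp]
  refine Finset.sum_congr rfl fun i _ => ?_
  rw [Finset.sum_eq_single i]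
  · rw [Matrix.one_apply_eq]; rfl
  · intro j _ hj
    rw [Matrix.one_apply_ne hj.symm]; simp
  · exact fun h => absurd (Finset.mem_univ _) h

theorem adjoint_compress (u : Matrix ι κ (Ell2 X →L[ℂ] Ell2 X)) :
    adjoint (compress S u) = compress S u.conjTranspose := by
  simp only [compress, map_sum, adjoint_comp, adjoint_adjoint, comp_assoc]
  rw [Finset.sum_comm]
  rfl

theorem norm_compress_le (u : Matrix ι κ (Ell2 X →L[ℂ] Ell2 X)) :
    ‖compress S u‖ ≤ ∑ i, ∑ j, ‖u i j‖ := by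
  refine (norm_sum_le _ _).trans (Finset.sum_le_sum fun i _ =>
    (norm_sum_le _ _).trans (Finset.sum_le_sum fun j _ => ?_))
  have h1 := norm_blockEmb_le S i
  have h2 := norm_blockEmb_le S j
  calc ‖adjoint (blockEmb S i) ∘L u i j ∘L blockEmb S j‖
      ≤ ‖adjoint (blockEmb S i)‖ * (‖u i j‖ * ‖blockEmb S j‖) :=
        (opNorm_comp_le _ _).trans (mul_le_mul_of_nonneg_left (opNorm_comp_le _ _) (norm_nonneg _))
    _ ≤ 1 * (‖u i j‖ * 1) := by
        rw [LinearIsometryEquiv.norm_map]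
        gcongr
    _ = ‖u i j‖ := by ring

theorem compress_map_mul_indicatorOp (u : Matrix ι κ (Ell2 X →L[ℂ] Ell2 X)) :
    compress S (u.map (· * indicatorOp (S : Set X))) = compress S u := by
  simp only [compress, Matrix.map_apply, mul_def, comp_assoc, indicatorOp_comp_blockEmb]

theorem compress_map_indicatorOp_mul (u : Matrix ι κ (Ell2 X →L[ℂ] Ell2 X)) :
    compress S (u.map (indicatorOp (S : Set X) * ·)) = compress S u := by
  simp only [compress, Matrix.map_apply, mul_def]
  simp only [← comp_assoc, adjoint_blockEmb_comp_indicatorOp]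

/-- Embeddings of different summands satisfy `blockEmb S j ∘L adjoint (blockEmb S k) = 0`, and equal
ones give the projection onto `ℓ²(S)`. Multiplying compressions thus inserts that projection between
the factors. -/
theorem compress_comp_compress (u : Matrix ι κ (Ell2 X →L[ℂ] Ell2 X))
    (v : Matrix κ μ (Ell2 X →L[ℂ] Ell2 X)) :
    compress S u ∘L compress S v = compress S (u * v.map (indicatorOp (S : Set X) * ·)) := by
  classical
  have key : ∀ i j, (adjoint (blockEmb S i) ∘L u i j ∘L blockEmb S j) ∘L compress S v =
      ∑ l, adjoint (blockEmb S i) ∘L (u i j ∘L indicatorOp (S : Set X) ∘L v j l) ∘L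
        blockEmb S l := fun i j => by
    simp only [compress, comp_finsetSum]
    rw [Finset.sum_eq_single j]
    · refine Finset.sum_congr rfl fun l _ => ?_
      have := blockEmb_comp_adjoint S j j
      rw [if_pos rfl] at this
      rw [← this]
      simp only [comp_assoc]
    · intro k _ hk
      refine Finset.sum_eq_zero fun l _ => ?_
      have := blockEmb_comp_adjoint S j k
      rw [if_neg hk.symm] at this
      calc _ = adjoint (blockEmb S i) ∘L u i j ∘L (blockEmb S j ∘L adjoint (blockEmb S k)) ∘L
            v k l ∘L blockEmb S l := by simp only [comp_assoc]
        _ = 0 := by rw [this]; simp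
    · exact fun h => absurd (Finset.mem_univ _) h
  conv_lhs => rw [compress]
  simp only [finsetSum_comp, key]
  rw [compress]
  refine Finset.sum_congr rfl fun i _ => ?_
  rw [Finset.sum_comm]
  refine Finset.sum_congr rfl fun l _ => ?_
  simp only [Matrix.mul_apply, Matrix.map_apply, mul_def, finsetSum_comp, comp_finsetSum]

/-- Compression is multiplicative if the entries of the right factor commute with the
projection onto `ℓ²(S)`. -/
theorem compress_comp_compress_of_commute (u : Matrix ι κ (Ell2 X →L[ℂ] Ell2 X))
    {v : Matrix κ μ (Ell2 X →L[ℂ] Ell2 X)}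
    (hv : ∀ i j, Commute (indicatorOp (S : Set X)) (v i j)) :
    compress S u ∘L compress S v = compress S (u * v) := by
  rw [compress_comp_compress, ← compress_map_mul_indicatorOp S (u * v)]
  congr 1
  ext1 i j
  simp only [Matrix.mul_apply, Matrix.map_apply, Finset.sum_mul, (hv _ _).eq, mul_assoc]

theorem compress_comp_compress_of_commute_left {u : Matrix ι κ (Ell2 X →L[ℂ] Ell2 X)}
    (v : Matrix κ μ (Ell2 X →L[ℂ] Ell2 X))
    (hu : ∀ i j, Commute (indicatorOp (S : Set X)) (u i j)) :
    compress S u ∘L compress S v = compress S (u * v) := by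
  rw [compress_comp_compress, ← compress_map_indicatorOp_mul S (u * v)]
  congr 1
  ext1 i j
  simp only [Matrix.mul_apply, Matrix.map_apply, Finset.mul_sum, ← mul_assoc, (hu _ _).eq]

/-- With `P` the projection onto `ℓ²(S)`, the defect is the compression of `-u (1 - P) v P`,
estimated entry by entry. -/
theorem norm_compress_comp_sub_le (u : Matrix ι κ (Ell2 X →L[ℂ] Ell2 X))
    (v : Matrix κ μ (Ell2 X →L[ℂ] Ell2 X)) :
    ‖compress S u ∘L compress S v - compress S (u * v)‖ ≤
      ∑ i, ∑ l, ∑ j,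
        ‖u i j‖ * ‖(1 - indicatorOp (S : Set X)) * v j l * indicatorOp (S : Set X)‖ := by
  have h : u * v.map (indicatorOp (S : Set X) * ·) - u * v =
      -(u * v.map ((1 - indicatorOp (S : Set X)) * ·)) := by
    rw [← Matrix.mul_sub, ← Matrix.mul_neg]
    congr 1
    ext1 i j
    simp [sub_mul]
  rw [compress_comp_compress, ← compress_sub, h, ← compress_map_mul_indicatorOp]
  refine (norm_compress_le S _).trans (Finset.sum_le_sum fun i _ => Finset.sum_le_sum fun l _ => ?_)
  rw [Matrix.map_apply, Matrix.neg_apply, neg_mul, norm_neg, Matrix.mul_apply, Finset.sum_mul]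
  refine (norm_sum_le _ _).trans (Finset.sum_le_sum fun j _ => ?_)
  rw [Matrix.map_apply, mul_assoc (u i j)]
  exact norm_mul_le _ _

end Compression

/-! ### Asymptotic multiplicativity of compressions -/

section Quasicentral

open ContinuousLinearMap Filter Topology

variable {X : Type*} [MetricSpace X]

/-- The projections onto `ℓ²(S k)` asymptotically commute with the uniform Roe algebra. -/
def IsQuasicentral (S : ℕ → Finset X) : Prop :=
  ∀ T ∈ uniformRoeAlgebra X, Tendsto
    (fun k => ‖(1 - indicatorOp (S k : Set X)) * T * indicatorOp (S k : Set X)‖) atTop (𝓝 0)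

/-- The map `T ↦ (1 - P) T P` is contractive for every one of the projections, so it suffices to
treat a dense set of operators. -/
theorem isQuasicentral_of_finitePropagation {S : ℕ → Finset X}
    (h : ∀ T ∈ algebraicRoe X, ∀ᶠ k in atTop,
      (1 - indicatorOp (S k : Set X)) * T * indicatorOp (S k : Set X) = 0) :
    IsQuasicentral S := by
  intro T hT
  rw [Metric.tendsto_nhds]
  intro ε hε
  obtain ⟨T₀, hT₀, hd⟩ := Metric.mem_closure_iff.mp hT ε hε
  filter_upwards [h T₀ hT₀] with k hk
  rw [dist_zero_right, norm_norm]
  have h1 := norm_one_sub_indicatorOp_mul_le (S k : Set X) (T - T₀)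
  rw [mul_sub, sub_mul, hk, sub_zero] at h1
  exact h1.trans_lt (by rwa [← dist_eq_norm])

/-- Once `F k` contains the ball of radius `R` about 1, points `g ∈ F k` and `x ∉ F k` are more than
`R` apart, because `g⁻¹ * x ∉ F k`. Operators of propagation at most `R` then leave `ℓ²(F k)`
invariant. -/
theorem IsExhaustion.isQuasicentral {G : Type*} [Group G] [MetricSpace G]
    {F : ℕ → Subgroup G} (hF : IsExhaustion F) (hp : ProperDiscreteMetric G)
    (hi : LeftInvariantMetric G) {S : ℕ → Finset G} (hS : ∀ k, (S k : Set G) = F k) :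
    IsQuasicentral S := by
  classical
  refine isQuasicentral_of_finitePropagation ?_
  rintro T ⟨R, -, hT⟩
  obtain ⟨k₀, hk₀⟩ := hF.exists_closedBall_subset hp R
  filter_upwards [eventually_ge_atTop k₀] with k hk
  ext ξ x
  rw [mul_assoc, sub_mul, one_mul]
  change (T (indicatorOp (S k : Set G) ξ)) x -
    indicatorOp (S k : Set G) (T (indicatorOp (S k : Set G) ξ)) x = 0
  rw [indicatorOp_apply]
  split_ifs with hx
  · exact sub_self _
  · rw [sub_zero, ← inner_delta_left, indicatorOp_eq_sum, sum_apply, map_sum, inner_sum]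
    refine Finset.sum_eq_zero fun g _ => ?_
    rw [InnerProductSpace.rankOne_apply, map_smul, inner_smul_right, hT, mul_zero]
    rw [dist_comm, ← hi.dist_one]
    refine not_le.mp fun hle => hx ?_
    rw [hS]
    have h1 : (g : G)⁻¹ * x ∈ F k := hF.mono hk (hk₀ hle)
    have h2 : (g : G) ∈ F k := by
      have := g.2
      rwa [← Finset.mem_coe, hS] at this
    simpa using mul_mem h2 h1

variable {ι κ μ : Type} [Fintype ι] [Fintype κ] [Fintype μ] {S : ℕ → Finset X}

/-- The matrix of operators underlying a matrix over the uniform Roe algebra. -/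
def toOps {ι κ : Type} (v : Matrix ι κ (uniformRoeAlgebra X)) :
    Matrix ι κ (Ell2 X →L[ℂ] Ell2 X) :=
  v.map (fun T => (T : Ell2 X →L[ℂ] Ell2 X))

theorem toOps_mul {ι μ : Type} (u : Matrix ι κ (uniformRoeAlgebra X))
    (v : Matrix κ μ (uniformRoeAlgebra X)) : toOps (u * v) = toOps u * toOps v :=
  Matrix.map_mul (f := (uniformRoeAlgebra X).subtype.toAlgHom.toRingHom)

theorem toOps_conjTranspose {ι κ : Type} (u : Matrix ι κ (uniformRoeAlgebra X)) :
    toOps u.conjTranspose = (toOps u).conjTranspose := rfl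

theorem IsQuasicentral.tendsto_compress (hS : IsQuasicentral S)
    (u : Matrix ι κ (uniformRoeAlgebra X)) (v : Matrix κ μ (uniformRoeAlgebra X)) :
    Tendsto (fun k => ‖compress (S k) (toOps u) ∘L compress (S k) (toOps v) -
      compress (S k) (toOps (u * v))‖) atTop (𝓝 0) := by
  simp only [toOps_mul]
  refine squeeze_zero (fun _ => norm_nonneg _)
    (fun k => norm_compress_comp_sub_le (S k) (toOps u) (toOps v)) ?_
  rw [show (0 : ℝ) = ∑ i : ι, ∑ l : μ, ∑ j : κ, ‖toOps u i j‖ * 0 by simp]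
  exact tendsto_finsetSum _ fun i _ => tendsto_finsetSum _ fun l _ => tendsto_finsetSum _
    fun j _ => (hS _ (v j l).2).const_mul _

/-- The projection close to the compression of a projection. -/
noncomputable def nearProj (S : Finset X) (p : Matrix ι ι (uniformRoeAlgebra X)) :
    EuclideanSpace ℂ (ι × S) →L[ℂ] EuclideanSpace ℂ (ι × S) :=
  cfc clip (compress S (toOps p))

theorem IsQuasicentral.eventually_nearProj (hS : IsQuasicentral S)
    {p : Matrix ι ι (uniformRoeAlgebra X)} (hp : IsStarProjection p) :
    ∀ᶠ k in atTop, IsStarProjection (nearProj (S k) p) ∧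
      ‖nearProj (S k) p - compress (S k) (toOps p)‖ ≤ 1 / 16 := by
  have h1 : p.conjTranspose = p := hp.isSelfAdjoint
  have h2 : p * p = p := hp.isIdempotentElem
  have ht := hS.tendsto_compress p p
  rw [h2] at ht
  -- `norm_cfc_clip_sub_le` doubles the defect 1/32 to the required 1/16.
  filter_upwards [ht.eventually_le_const (show (0 : ℝ) < 1 / 32 by norm_num)] with k hk
  have hsa : IsSelfAdjoint (compress (S k) (toOps p)) := by
    change adjoint _ = _
    rw [adjoint_compress, ← toOps_conjTranspose, h1]
  refine ⟨isStarProjection_cfc_clip hsa (hk.trans (by norm_num)), ?_⟩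
  exact (norm_cfc_clip_sub_le hsa hk (by norm_num)).trans (by norm_num)

/-- Murray-von Neumann equivalent projections eventually have the same compressed rank. -/
theorem IsQuasicentral.eventually_opRank_eq (hS : IsQuasicentral S)
    {p : Matrix ι ι (uniformRoeAlgebra X)} {q : Matrix κ κ (uniformRoeAlgebra X)}
    (hp : IsStarProjection p) (hq : IsStarProjection q) (h : MvN p q) :
    ∀ᶠ k in atTop, opRank (nearProj (S k) p) = opRank (nearProj (S k) q) := by
  obtain ⟨v, h1, h2⟩ := h
  have ht := hS.tendsto_compress v.conjTranspose v
  have ht' := hS.tendsto_compress v v.conjTranspose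
  rw [h1] at ht
  rw [h2] at ht'
  -- The errors 1/16 from rounding and 1/8 from multiplicativity stay below the 1/4 allowed by the
  -- rank comparison.
  have h8 : (0 : ℝ) < 1 / 8 := by norm_num
  filter_upwards [ht.eventually_le_const h8, ht'.eventually_le_const h8, hS.eventually_nearProj hp,
    hS.eventually_nearProj hq] with k hk hk' hpk hqk
  have hadj : adjoint (compress (S k) (toOps v)) = compress (S k) (toOps v.conjTranspose) := by
    rw [adjoint_compress, toOps_conjTranspose]
  refine opRank_eq_of_norm_sub_le hpk.1.isIdempotentElem hqk.1.isIdempotentElem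
    (compress (S k) (toOps v)) ?_ ?_
  · rw [hadj]
    have := norm_sub_le_norm_sub_add_norm_sub (nearProj (S k) p) (compress (S k) (toOps p))
      (compress (S k) (toOps v.conjTranspose) ∘L compress (S k) (toOps v))
    rw [norm_sub_rev (compress (S k) (toOps p))] at this
    linarith [hpk.2]
  · rw [hadj]
    have := norm_sub_le_norm_sub_add_norm_sub (nearProj (S k) q) (compress (S k) (toOps q))
      (compress (S k) (toOps v) ∘L compress (S k) (toOps v.conjTranspose))
    rw [norm_sub_rev (compress (S k) (toOps q))] at this
    linarith [hqk.2]

end Quasicentral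

/-! ### The rank homomorphism on `K₀` -/

section Additivity

open ContinuousLinearMap Filter Topology

/-- The conjugating rectangular matrices have entries 0 and 1, which commute with the projection
onto `ℓ²(S)`. Compression is therefore exactly, not just approximately, compatible with orthogonal
sums. -/
theorem blockSum_eq_conj {R : Type*} [Ring R] [StarRing R] {ι κ : Type} [Fintype ι] [Fintype κ]
    [DecidableEq ι] [DecidableEq κ] (p : Matrix ι ι R) (q : Matrix κ κ R) :
    blockSum p q =
      (Matrix.fromCols (1 : Matrix ι ι R) (0 : Matrix ι κ R)).conjTranspose *
        (p * Matrix.fromCols (1 : Matrix ι ι R) (0 : Matrix ι κ R)) +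
      (Matrix.fromCols (0 : Matrix κ ι R) (1 : Matrix κ κ R)).conjTranspose *
        (q * Matrix.fromCols (0 : Matrix κ ι R) (1 : Matrix κ κ R)) := by
  have hp : p * Matrix.fromCols (1 : Matrix ι ι R) (0 : Matrix ι κ R) = Matrix.fromCols p 0 := by
    simp [Matrix.mul_fromCols]
  have hq : q * Matrix.fromCols (0 : Matrix κ ι R) (1 : Matrix κ κ R) = Matrix.fromCols 0 q := by
    simp [Matrix.mul_fromCols]
  rw [hp, hq, Matrix.conjTranspose_fromCols_eq_fromRows_conjTranspose,
    Matrix.conjTranspose_fromCols_eq_fromRows_conjTranspose, Matrix.fromRows_mul_fromCols,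
    Matrix.fromRows_mul_fromCols, Matrix.fromBlocks_add]
  simp [blockSum]

variable {X : Type*} {ι κ : Type}

theorem commute_fromCols {R : Type*} [Ring R] {l m n : Type} {a : R} {u : Matrix l m R}
    {v : Matrix l n R} (hu : ∀ i j, Commute a (u i j)) (hv : ∀ i j, Commute a (v i j)) (i : l)
    (j : m ⊕ n) : Commute a (Matrix.fromCols u v i j) := by
  rcases j with j | j
  · exact hu i j
  · exact hv i j

theorem commute_matrix_one {R : Type*} [Ring R] [DecidableEq ι] (a : R) (i j : ι) :
    Commute a ((1 : Matrix ι ι R) i j) := by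
  rw [Matrix.one_apply]
  split_ifs
  · exact Commute.one_right a
  · exact Commute.zero_right a

variable [Fintype ι] [Fintype κ]

theorem norm_conj_le {E K : Type*} [NormedAddCommGroup E] [InnerProductSpace ℂ E]
    [CompleteSpace E] [NormedAddCommGroup K] [InnerProductSpace ℂ K] [CompleteSpace K]
    {w : K →L[ℂ] E} (h : w ∘L adjoint w = 1) (T : E →L[ℂ] E) :
    ‖adjoint w ∘L T ∘L w‖ ≤ ‖T‖ := by
  have h1 := norm_adjoint_comp_self (adjoint w)
  rw [adjoint_adjoint, h, LinearIsometryEquiv.norm_map] at h1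
  have h2 : ‖(1 : E →L[ℂ] E)‖ ≤ 1 := norm_id_le
  have h3 : ‖w‖ ≤ 1 := by nlinarith [norm_nonneg w]
  calc _ ≤ ‖adjoint w‖ * (‖T‖ * ‖w‖) :=
        (opNorm_comp_le _ _).trans (mul_le_mul_of_nonneg_left (opNorm_comp_le _ _) (norm_nonneg _))
    _ ≤ 1 * (‖T‖ * 1) := by
        rw [LinearIsometryEquiv.norm_map]
        gcongr
    _ = ‖T‖ := by ring

/-- Compressions of orthogonal sums are orthogonal sums of compressions. -/
theorem exists_compress_blockSum (S : Finset X) :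
    ∃ (w : EuclideanSpace ℂ ((ι ⊕ κ) × S) →L[ℂ] EuclideanSpace ℂ (ι × S))
      (w' : EuclideanSpace ℂ ((ι ⊕ κ) × S) →L[ℂ] EuclideanSpace ℂ (κ × S)),
      w ∘L adjoint w = 1 ∧ w' ∘L adjoint w' = 1 ∧ w ∘L adjoint w' = 0 ∧
      ∀ p q, compress S (blockSum p q) =
        adjoint w ∘L compress S p ∘L w + adjoint w' ∘L compress S q ∘L w' := by
  classical
  let u : Matrix ι (ι ⊕ κ) (Ell2 X →L[ℂ] Ell2 X) := Matrix.fromCols 1 0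
  let u' : Matrix κ (ι ⊕ κ) (Ell2 X →L[ℂ] Ell2 X) := Matrix.fromCols 0 1
  have hu : ∀ i j, Commute (indicatorOp (S : Set X)) (u i j) :=
    commute_fromCols (commute_matrix_one _) fun _ _ => Commute.zero_right _
  have hu' : ∀ i j, Commute (indicatorOp (S : Set X)) (u' i j) :=
    commute_fromCols (fun _ _ => Commute.zero_right _) (commute_matrix_one _)
  have hus : ∀ i j, Commute (indicatorOp (S : Set X)) (u.conjTranspose i j) := fun i j => by
    have := (hu j i).star_star
    rwa [(isStarProjection_indicatorOp _).isSelfAdjoint.star_eq] at this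
  have hus' : ∀ i j, Commute (indicatorOp (S : Set X)) (u'.conjTranspose i j) := fun i j => by
    have := (hu' j i).star_star
    rwa [(isStarProjection_indicatorOp _).isSelfAdjoint.star_eq] at this
  refine ⟨compress S u, compress S u', ?_, ?_, ?_, fun p q => ?_⟩
  · rw [adjoint_compress, compress_comp_compress_of_commute_left S _ hu, ← compress_one]
    congr 1
    simp [u, Matrix.conjTranspose_fromCols_eq_fromRows_conjTranspose, Matrix.fromCols_mul_fromRows]
  · rw [adjoint_compress, compress_comp_compress_of_commute_left S _ hu', ← compress_one]
    congr 1
    simp [u', Matrix.conjTranspose_fromCols_eq_fromRows_conjTranspose, Matrix.fromCols_mul_fromRows]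
  · rw [adjoint_compress, compress_comp_compress_of_commute_left S _ hu, ← compress_zero]
    congr 1
    simp [u, u', Matrix.conjTranspose_fromCols_eq_fromRows_conjTranspose,
      Matrix.fromCols_mul_fromRows]
  · rw [adjoint_compress, adjoint_compress, blockSum_eq_conj, compress_add,
      compress_comp_compress_of_commute S p hu, compress_comp_compress_of_commute S q hu',
      compress_comp_compress_of_commute_left S _ hus,
      compress_comp_compress_of_commute_left S _ hus']

variable [MetricSpace X] {S : ℕ → Finset X}

theorem toOps_blockSum {ι κ : Type} (p : Matrix ι ι (uniformRoeAlgebra X))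
    (q : Matrix κ κ (uniformRoeAlgebra X)) :
    toOps (blockSum p q) = blockSum (toOps p) (toOps q) := by
  ext1 (i | i) (j | j) <;> rfl

theorem IsQuasicentral.eventually_opRank_blockSum (hS : IsQuasicentral S)
    {p : Matrix ι ι (uniformRoeAlgebra X)} {q : Matrix κ κ (uniformRoeAlgebra X)}
    (hp : IsStarProjection p) (hq : IsStarProjection q) :
    ∀ᶠ k in atTop, opRank (nearProj (S k) (blockSum p q)) =
      opRank (nearProj (S k) p) + opRank (nearProj (S k) q) := by
  filter_upwards [hS.eventually_nearProj hp, hS.eventually_nearProj hq,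
    hS.eventually_nearProj (blockSum_proj hp hq)] with k hpk hqk hk
  obtain ⟨w, w', h1, h2, h3, h4⟩ := exists_compress_blockSum (ι := ι) (κ := κ) (S k)
  obtain ⟨hs, hrank⟩ := isStarProjection_orthogonal_sum hpk.1 hqk.1 h1 h2 h3
  rw [← hrank]
  -- Three roundings, of `p`, `q` and their sum, cost 1/16 each; the total 3/16 is below 1/4.
  refine (opRank_eq_of_norm_sub_le' hs hk.1 ?_).symm
  set e := nearProj (S k) p
  set f := nearProj (S k) q
  have h5 : compress (S k) (toOps (blockSum p q)) -
      (adjoint w ∘L e ∘L w + adjoint w' ∘L f ∘L w') =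
      -(adjoint w ∘L (e - compress (S k) (toOps p)) ∘L w +
        adjoint w' ∘L (f - compress (S k) (toOps q)) ∘L w') := by
    rw [toOps_blockSum, h4]
    simp only [sub_comp, comp_sub]
    abel
  have h6 : ‖compress (S k) (toOps (blockSum p q)) -
      (adjoint w ∘L e ∘L w + adjoint w' ∘L f ∘L w')‖ ≤ 1 / 16 + 1 / 16 := by
    rw [h5, norm_neg]
    exact (norm_add_le _ _).trans (add_le_add ((norm_conj_le h1 _).trans hpk.2)
      ((norm_conj_le h2 _).trans hqk.2))
  have h7 := norm_sub_le_norm_sub_add_norm_sub (nearProj (S k) (blockSum p q))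
    (compress (S k) (toOps (blockSum p q))) (adjoint w ∘L e ∘L w + adjoint w' ∘L f ∘L w')
  linarith [hk.2]

/-- The compression of 1 is the identity and `clip 1 = 1`, so the rank is the full dimension. -/
theorem opRank_nearProj_one [DecidableEq ι] (S : Finset X) :
    opRank (nearProj S (1 : Matrix ι ι (uniformRoeAlgebra X))) = Fintype.card ι * S.card := by
  have h : toOps (1 : Matrix ι ι (uniformRoeAlgebra X)) = 1 := Matrix.map_one _ rfl rfl
  rw [nearProj, h, compress_one, cfc_apply_one, clip_one, map_one, opRank_one,
    finrank_euclideanSpace, Fintype.card_prod, Fintype.card_coe]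

/-- The eventual ranks of the compressions of a matrix projection. -/
noncomputable def IsQuasicentral.rankHom (hS : IsQuasicentral S) :
    MvNSemigroup (uniformRoeAlgebra X) →+ Germ (atTop : Filter ℕ) ℤ := by
  -- Ranks are invariant and additive only from some `k` on, depending on the projections; hence
  -- germs at infinity. Integer values make the target a group, so that the map extends to `K0`.
  let f : MvNSemigroup (uniformRoeAlgebra X) → Germ (atTop : Filter ℕ) ℤ :=
    Quotient.lift (fun p => ((fun k => (opRank (nearProj (S k) p.2.1) : ℤ) : ℕ → ℤ) :
      Germ (atTop : Filter ℕ) ℤ)) fun p q h => Germ.coe_eq.mpr <| by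
        filter_upwards [hS.eventually_opRank_eq p.2.2 q.2.2 h] with k hk
        rw [hk]
  have hf : ∀ a b, f (a + b) = f a + f b := fun a b => by
    induction a using Quotient.inductionOn with | _ p => ?_
    induction b using Quotient.inductionOn with | _ q => ?_
    refine Germ.coe_eq.mpr ?_
    filter_upwards [hS.eventually_opRank_eq (blockSum_proj p.2.2 q.2.2) (p.sum q).2.2
      (p.mvn_sum q), hS.eventually_opRank_blockSum p.2.2 q.2.2] with k hk hk'
    rw [← hk, hk', Nat.cast_add]
  -- In a group, `f 0 = f 0 + f 0` already forces `f 0 = 0`.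
  exact { toFun := f, map_zero' := by simpa using hf 0 0, map_add' := hf }

/-- If `n` divides the class of the unit, then it divides the cardinality of some `S k`. -/
theorem IsQuasicentral.exists_dvd_card (hS : IsQuasicentral S) {n : ℕ}
    {x : K0 (uniformRoeAlgebra X)} (hx : n • x = K0.unit _) : ∃ k, n ∣ (S k).card := by
  have h := congrArg (Algebra.GrothendieckAddGroup.lift hS.rankHom) hx
  have h1 : Algebra.GrothendieckAddGroup.lift hS.rankHom (K0.unit _) =
      hS.rankHom (MvNSemigroup.mk ⟨1, 1, IsStarProjection.one _⟩) := K0.lift_of _ _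
  rw [map_nsmul, h1] at h
  -- The image of `x` is the germ of an integer sequence `r`, and `n * r k` equals the rank of the
  -- compressed unit, `|S k|`, for all large `k`; a single such `k` is enough.
  obtain ⟨r, hr⟩ := Quotient.exists_rep (Algebra.GrothendieckAddGroup.lift hS.rankHom x)
  rw [← hr] at h
  have h' : (fun k => n • r k) =ᶠ[atTop] fun k => (opRank (nearProj (S k)
      (1 : Matrix (Fin 1) (Fin 1) (uniformRoeAlgebra X))) : ℤ) := Germ.coe_eq.mp h
  obtain ⟨k, hk⟩ := h'.exists
  have hone := opRank_nearProj_one (ι := Fin 1) (S k)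
  rw [Fintype.card_fin, one_mul] at hone
  have hk : n • r k = (opRank (nearProj (S k)
    (1 : Matrix (Fin 1) (Fin 1) (uniformRoeAlgebra X))) : ℤ) := hk
  rw [hone] at hk
  exact ⟨k, Int.natCast_dvd_natCast.mp ⟨r k, by rw [← hk, nsmul_eq_mul]⟩⟩

end Additivity

/-! ### From pointed `K0` to divisibility of subgroup orders -/

section Main

variable {G G' : Type*} [Group G] [Group G'] [MetricSpace G] [MetricSpace G']

/-- Translations in `G` divide the unit by `|F k|`, the isomorphism carries the quotient over, and
ranks in `G'` turn it into divisibility of an order. -/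
theorem PointedK0Iso.exists_card_dvd
    (h : PointedK0Iso (uniformRoeAlgebra G) (uniformRoeAlgebra G'))
    {F : ℕ → Subgroup G} {F' : ℕ → Subgroup G'} (hF : IsExhaustion F) (hF' : IsExhaustion F')
    (hp' : ProperDiscreteMetric G') (hi : LeftInvariantMetric G) (hi' : LeftInvariantMetric G')
    (k : ℕ) : ∃ j, Nat.card (F k) ∣ Nat.card (F' j) := by
  obtain ⟨φ, hφ⟩ := h
  have := hF.finite k
  have := hF'.finite
  obtain ⟨x, hx⟩ := exists_card_nsmul_eq_unit hi (F k)
  let S : ℕ → Finset G' := fun j => (Set.toFinite (F' j : Set G')).toFinset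
  have hS : IsQuasicentral S := hF'.isQuasicentral hp' hi' fun j => Set.Finite.coe_toFinset _
  obtain ⟨j, hj⟩ := hS.exists_dvd_card (x := φ x) (by rw [← map_nsmul, hx, hφ])
  have hc : (S j).card = Nat.card (F' j) := (Set.ncard_eq_toFinset_card _ _).symm
  exact ⟨j, hc ▸ hj⟩

theorem PointedK0Iso.symm {A B : Type*} [Ring A] [StarRing A] [Ring B] [StarRing B]
    (h : PointedK0Iso A B) : PointedK0Iso B A :=
  let ⟨φ, hφ⟩ := h
  ⟨φ.symm, by rw [← hφ, φ.symm_apply_apply]⟩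

end Main

end UniformRoe

theorem theorem4p10 {Γ Λ : Type*} [Group Γ] [Group Λ] [Countable Γ] [Countable Λ]
    [MetricSpace Γ] [MetricSpace Λ]
    (hΓ : UniformRoe.LocallyFiniteGroup Γ) (hΛ : UniformRoe.LocallyFiniteGroup Λ)
    (hΓp : UniformRoe.ProperDiscreteMetric Γ) (hΛp : UniformRoe.ProperDiscreteMetric Λ)
    (hΓi : UniformRoe.LeftInvariantMetric Γ) (hΛi : UniformRoe.LeftInvariantMetric Λ) :
    List.TFAE [
      UniformRoe.BijectivelyCoarselyEquivalent Γ Λ,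
      ∃ φ : UniformRoe.uniformRoeAlgebra Γ ≃⋆ₐ[ℂ] UniformRoe.uniformRoeAlgebra Λ,
        φ '' UniformRoe.ellInfty Γ = UniformRoe.ellInfty Λ,
      Nonempty (UniformRoe.uniformRoeAlgebra Γ ≃⋆ₐ[ℂ] UniformRoe.uniformRoeAlgebra Λ),
      UniformRoe.OrderedK0Iso (UniformRoe.uniformRoeAlgebra Γ) (UniformRoe.uniformRoeAlgebra Λ),
      UniformRoe.PointedK0Iso (UniformRoe.uniformRoeAlgebra Γ)
        (UniformRoe.uniformRoeAlgebra Λ)] := by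
  tfae_have 1 → 2 := fun h => h.exists_starAlgEquiv
  tfae_have 2 → 3 := fun ⟨φ, _⟩ => ⟨φ⟩
  tfae_have 3 → 4 := fun ⟨φ⟩ => UniformRoe.orderedK0Iso_of_starAlgEquiv φ
  tfae_have 4 → 5 := fun h => h.pointedK0Iso
  tfae_have 5 → 1 := fun h => by
    obtain ⟨F, hF⟩ := hΓ.exists_isExhaustion
    obtain ⟨F', hF'⟩ := hΛ.exists_isExhaustion
    exact UniformRoe.bijectivelyCoarselyEquivalent_of_card_dvd hF hF' hΓp hΛp hΓi hΛi
      (h.exists_card_dvd hF hF' hΛp hΓi hΛi) (h.symm.exists_card_dvd hF' hF hΓp hΛi hΓi)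
  tfae_finish
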